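/- Let $G=(V,E)$ be an infinite, connected, locally finite, vertex-transitive (simple) graph. For $p\in[0,1]$, let $\mathrm P_p$ denote Bernoulli bond percolation on $G$, under which each edge is open with probability $p$ independently of all others. For a set of vertices $S$, let $\mathcal C_S$ be the set of vertices connected to some vertex of $S$ by a (possibly trivial) path of open edges, and write $S\leftrightarrow\infty$ if $\mathcal C_S$ is infinite. Fix a vertex $o$ and let $$p_c:=\inf\{p\in[0,1] : \mathrm P_p(\{o\}\leftrightarrow\infty)>0\}.$$ For a set $T\subseteq V$ let $\partial T$ be the set of edges with exactly one endpoint in $T$, and for a finite set $W\subseteq V$ define $$\Phi(W):=\min\{|\partial T| : W\subseteq T\subseteq V,\ |T|<\infty\}.$$ **Theorem 1.2.** For every $p\in[0,1]$ with $p>p_c$ there exists $c>0$ (depending only on $G$ and $p$) such that for every finite set of vertices $S$ and every integer $n\ge 1$, $$\mathrm P_p\bigl(S\not\leftrightarrow\infty\ \text{ and }\ \Phi(\mathcal C_S)\ge n\bigr)\le e^{-cn}.$$ -/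

import Mathlib

open MeasureTheory ProbabilityTheory unitInterval

namespace Percolation

/-- `G` is (vertex-)transitive: its automorphism group acts transitively on the vertices. -/
def IsTransitive {V : Type*} (G : SimpleGraph V) : Prop :=
  ∀ u v : V, ∃ φ : G ≃g G, φ u = v

/-- The edge boundary `∂A`: the edges of `G` with exactly one endpoint in `A`. -/
def edgeBoundary {V : Type*} (G : SimpleGraph V) (A : Set V) : Set (Sym2 V) :=
  {e | e ∈ G.edgeSet ∧ ∃ u v : V, e = s(u, v) ∧ u ∈ A ∧ v ∉ A}

/-- `Φ(W) = min {|∂T| : W ⊆ T, T finite}`, with values in `ℕ∞`. If `W` is finite, the infimum is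
over a nonempty family and hence attained; if `W` is infinite, the value is `⊤`. -/
noncomputable def cutsetSize {V : Type*} (G : SimpleGraph V) (W : Set V) : ℕ∞ :=
  ⨅ (T : Set V) (_ : W ⊆ T) (_ : T.Finite), (edgeBoundary G T).encard

/-- The percolation measure `P_p` on `G`. A configuration is identified with the set of its
open edges: each edge of `G` is open with probability `p`, independently of all others, and pairs
that are not edges of `G` are never open. -/
noncomputable def percolationMeasure {V : Type*} (G : SimpleGraph V) (p : I) :
    Measure (Set (Sym2 V)) :=
  setBer(G.edgeSet, p)

/-- The cluster of the vertex set `S` in the configuration `ω`: all vertices connected to some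
vertex of `S` in the graph `(V, ω)`. -/
def cluster {V : Type*} (ω : Set (Sym2 V)) (S : Set V) : Set V :=
  {v | ∃ s ∈ S, (SimpleGraph.fromEdgeSet ω).Reachable s v}

/-- `S ↔ ∞`: the set of vertices connected to `S` is infinite. -/
def ConnectedToInfinity {V : Type*} (ω : Set (Sym2 V)) (S : Set V) : Prop :=
  (cluster ω S).Infinite

/-- The critical point `p_c = inf {p ∈ [0,1] : P_p(o ↔ ∞) > 0}`. -/
noncomputable def criticalPoint {V : Type*} (G : SimpleGraph V) (o : V) : ℝ :=
  sInf {x : ℝ | ∃ p : I, (p : ℝ) = x ∧ 0 < percolationMeasure G p {ω | ConnectedToInfinity ω {o}}}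

end Percolation

/-! Choose levels `p₀ < p₁ < p` such that the cluster of a vertex is infinite with probability `θ >
0` at level `p₀`. Sprinkling writes a level-`p₁` configuration as a union of independent layers, and
likewise a level-`p` configuration from level `p₁`. All estimates are made in a finite volume `Λ`,
whose complement plays the role of infinity, with constants independent of `Λ`.

Deterministic sets come first (`exists_probInside_le_pow`): if every finite set containing `S` has
at least `n` boundary edges, then at level `p₁` the cluster of `S` stays in `Λ` with probability
exponentially small in `n`. By transitivity, balls of a large fixed radius are very unlikely to be
disconnected from infinity. Explored vertices carry labels: `0` for infinity, `1` for `S`, and one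
further label for each other explored piece. The set of vertices whose ball is likely to touch a
nonzero label contains `S`, so it has many boundary edges; near such an edge a ball is likely to
touch label `0` and, by the Harris inequality, a nonzero label at the same time. With probability
bounded below all edges of that ball are open in the third layer. Exploring from it then connects
`0` to `1`, or merges another label into `0`. A new label is created only when nothing is touched,
which is much less likely. Hence `2 ^ (number of labels)` times the probability of separation
contracts at each step (`exploration_step`, `sepProb_le`), and about `n` steps with well separated
balls are available.

The random cluster `C` of `S` is reduced to this case by a second sprinkling (`bexp_cluster_le`).
Consider the boundary edges of `C` whose outer endpoint is joined to the outside of `Λ` off `C` at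
level `p₁`. If they are few, closing them would disconnect the deterministic set `C` at small cost,
which the first part makes unlikely. If they are many, they must all be closed in the sprinkled
layer, which is again exponentially unlikely.

Letting `Λ` exhaust `V` gives the bound up to a factor `2`. The uniform bound `1 - θ` for nonempty
`S` takes care of small `n` and removes the factor (`exists_exp_bound`). -/

namespace Percolation

/-! ### Expectations over finite Bernoulli sets: independence, Harris, sprinkling, decoupling. -/

section BernoulliExpectation

open Classical

variable {ι : Type*} [DecidableEq ι]

/-- The expectation of `f A`, where `A` is a random subset of the finite set `s` containing each
element independently with probability `p`. -/
noncomputable def bexp (s : Finset ι) (p : ℝ) (f : Finset ι → ℝ) : ℝ :=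
  ∑ A ∈ s.powerset, p ^ A.card * (1 - p) ^ (s \ A).card * f A

theorem bexp_empty (p : ℝ) (f : Finset ι → ℝ) : bexp ∅ p f = f ∅ := by
  simp [bexp]

theorem bexp_insert {i : ι} {s : Finset ι} (hi : i ∉ s) (p : ℝ) (f : Finset ι → ℝ) :
    bexp (insert i s) p f = p * bexp s p (fun A => f (insert i A)) + (1 - p) * bexp s p f := by
  unfold bexp
  rw [Finset.sum_powerset_insert hi, add_comm, Finset.mul_sum, Finset.mul_sum]
  congr 1
  · refine Finset.sum_congr rfl fun A hA => ?_
    have hiA : i ∉ A := fun h => hi (Finset.mem_powerset.1 hA h)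
    have h1 : insert i s \ insert i A = s \ A := by
      ext x; simp only [Finset.mem_sdiff, Finset.mem_insert]
      by_cases hx : x = i
      · subst hx; simp [hi]
      · simp [hx]
    rw [Finset.card_insert_of_notMem hiA, h1]; ring
  · refine Finset.sum_congr rfl fun A hA => ?_
    have hiA : i ∉ A := fun h => hi (Finset.mem_powerset.1 hA h)
    have h1 : insert i s \ A = insert i (s \ A) := by
      rw [Finset.insert_sdiff_of_notMem _ hiA]
    rw [h1, Finset.card_insert_of_notMem (by simp [hi])]; ring

theorem bexp_congr {s : Finset ι} {p : ℝ} {f g : Finset ι → ℝ} (h : ∀ A ⊆ s, f A = g A) :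
    bexp s p f = bexp s p g :=
  Finset.sum_congr rfl fun A hA => by rw [h A (Finset.mem_powerset.1 hA)]

theorem bexp_const (s : Finset ι) (p c : ℝ) : bexp s p (fun _ => c) = c := by
  induction s using Finset.induction_on with
  | empty => simp [bexp_empty]
  | insert i s hi ih => rw [bexp_insert hi, ih]; ring

theorem bexp_mono {s : Finset ι} {p : ℝ} (h0 : 0 ≤ p) (h1 : p ≤ 1) {f g : Finset ι → ℝ}
    (h : ∀ A ⊆ s, f A ≤ g A) : bexp s p f ≤ bexp s p g :=
  Finset.sum_le_sum fun A hA => mul_le_mul_of_nonneg_left (h A (Finset.mem_powerset.1 hA))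
    (mul_nonneg (pow_nonneg h0 _) (pow_nonneg (by linarith) _))

theorem bexp_le {s : Finset ι} {p : ℝ} (h0 : 0 ≤ p) (h1 : p ≤ 1) {f : Finset ι → ℝ} {c : ℝ}
    (h : ∀ A ⊆ s, f A ≤ c) : bexp s p f ≤ c :=
  (bexp_mono h0 h1 h).trans_eq (bexp_const s p c)

theorem le_bexp {s : Finset ι} {p : ℝ} (h0 : 0 ≤ p) (h1 : p ≤ 1) {f : Finset ι → ℝ} {c : ℝ}
    (h : ∀ A ⊆ s, c ≤ f A) : c ≤ bexp s p f :=
  (bexp_const s p c).symm.trans_le (bexp_mono h0 h1 h)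

theorem bexp_add (s : Finset ι) (p : ℝ) (f g : Finset ι → ℝ) :
    bexp s p (fun A => f A + g A) = bexp s p f + bexp s p g := by
  simp [bexp, mul_add, Finset.sum_add_distrib]

theorem bexp_mul_left (s : Finset ι) (p c : ℝ) (f : Finset ι → ℝ) :
    bexp s p (fun A => c * f A) = c * bexp s p f := by
  rw [bexp, bexp, Finset.mul_sum]
  exact Finset.sum_congr rfl fun A _ => by ring

theorem bexp_sub (s : Finset ι) (p : ℝ) (f g : Finset ι → ℝ) :
    bexp s p (fun A => f A - g A) = bexp s p f - bexp s p g := by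
  simp [bexp, mul_sub, Finset.sum_sub_distrib]

theorem bexp_sum {κ : Type*} (K : Finset κ) (s : Finset ι) (p : ℝ) (f : κ → Finset ι → ℝ) :
    bexp s p (fun A => ∑ k ∈ K, f k A) = ∑ k ∈ K, bexp s p (f k) := by
  simp only [bexp, Finset.mul_sum]
  exact Finset.sum_comm

theorem bexp_comm {κ : Type*} [DecidableEq κ] (s : Finset ι) (t : Finset κ) (p q : ℝ)
    (f : Finset ι → Finset κ → ℝ) :
    bexp s p (fun A => bexp t q (fun B => f A B)) =
      bexp t q (fun B => bexp s p (fun A => f A B)) := by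
  simp only [bexp, Finset.mul_sum]
  rw [Finset.sum_comm]
  exact Finset.sum_congr rfl fun A _ => Finset.sum_congr rfl fun B _ => by ring

theorem bexp_union {s t : Finset ι} (hst : Disjoint s t) (p : ℝ) (f : Finset ι → ℝ) :
    bexp (s ∪ t) p f = bexp s p (fun A => bexp t p (fun B => f (A ∪ B))) := by
  induction s using Finset.induction_on generalizing f with
  | empty => simp [bexp_empty]
  | insert i s hi ih =>
    rw [Finset.disjoint_insert_left] at hst
    rw [Finset.insert_union, bexp_insert (by simp [hi, hst.1]), bexp_insert hi, ih hst.2, ih hst.2]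
    simp only [Finset.insert_union]

/-- If `f A` only depends on `A ∩ t`, its expectation can be computed on `t`. -/
theorem bexp_restrict {s t : Finset ι} (hts : t ⊆ s) (p : ℝ) {f : Finset ι → ℝ}
    (hf : ∀ A ⊆ s, f (A ∩ t) = f A) : bexp s p f = bexp t p f := by
  have hs : s = t ∪ (s \ t) := (Finset.union_sdiff_of_subset hts).symm
  have hd : Disjoint t (s \ t) := Finset.disjoint_sdiff
  rw [hs, bexp_union hd]
  refine bexp_congr fun A hA => ?_
  rw [bexp_congr (g := fun _ => f A), bexp_const]
  intro B hB
  have h1 : A ∪ B ⊆ s := Finset.union_subset (hA.trans hts) (hB.trans Finset.sdiff_subset)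
  rw [← hf _ h1]
  congr 1
  rw [Finset.union_inter_distrib_right, Finset.inter_eq_left.2 hA,
    Finset.disjoint_iff_inter_eq_empty.1 (hd.symm.mono_left hB), Finset.union_empty]

/-- Functions of disjoint sets of coordinates are independent. -/
theorem bexp_mul_of_disjoint {s t : Finset ι} (hts : t ⊆ s) (p : ℝ) {f g : Finset ι → ℝ}
    (hf : ∀ A ⊆ s, f (A ∩ t) = f A) (hg : ∀ A ⊆ s, g (A \ t) = g A) :
    bexp s p (fun A => f A * g A) = bexp s p f * bexp s p g := by
  have hs : s = t ∪ (s \ t) := (Finset.union_sdiff_of_subset hts).symm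
  have hd : Disjoint t (s \ t) := Finset.disjoint_sdiff
  have key : ∀ A ⊆ t, ∀ B ⊆ s \ t, f (A ∪ B) = f A ∧ g (A ∪ B) = g B := by
    intro A hA B hB
    have h1 : A ∪ B ⊆ s := Finset.union_subset (hA.trans hts) (hB.trans Finset.sdiff_subset)
    have hBt : Disjoint B t := hd.symm.mono_left hB
    constructor
    · rw [← hf _ h1, Finset.union_inter_distrib_right, Finset.inter_eq_left.2 hA,
        Finset.disjoint_iff_inter_eq_empty.1 hBt, Finset.union_empty]
    · rw [← hg _ h1, Finset.union_sdiff_distrib, Finset.sdiff_eq_empty_iff_subset.2 hA,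
        Finset.empty_union, Finset.sdiff_eq_self_of_disjoint hBt]
  have e1 : bexp s p f = bexp t p f := bexp_restrict hts p hf
  have e2 : bexp s p g = bexp (s \ t) p g := by
    refine bexp_restrict Finset.sdiff_subset p fun A hA => ?_
    rw [← hg A hA]; congr 1
    ext x; simp only [Finset.mem_inter, Finset.mem_sdiff]
    exact ⟨fun h => ⟨h.1, h.2.2⟩, fun h => ⟨h.1, hA h.1, h.2⟩⟩
  rw [e1, e2]
  conv_lhs => rw [hs]
  rw [bexp_union hd, mul_comm (bexp t p f), ← bexp_mul_left]
  refine bexp_congr fun A hA => ?_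
  rw [mul_comm, ← bexp_mul_left]
  exact bexp_congr fun B hB => by rw [(key A hA B hB).1, (key A hA B hB).2]

/-- The Harris inequality. -/
theorem bexp_mul_le {p : ℝ} (h0 : 0 ≤ p) (h1 : p ≤ 1) (s : Finset ι) {f g : Finset ι → ℝ}
    (hf : ∀ ⦃A B⦄, A ⊆ B → f A ≤ f B) (hg : ∀ ⦃A B⦄, A ⊆ B → g A ≤ g B) :
    bexp s p f * bexp s p g ≤ bexp s p (fun A => f A * g A) := by
  induction s using Finset.induction_on generalizing f g with
  | empty => simp [bexp_empty]
  | insert i s hi ih =>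
    rw [bexp_insert hi, bexp_insert hi, bexp_insert hi]
    have a1 := ih (f := fun A => f (insert i A)) (g := fun A => g (insert i A))
      (fun A B h => hf (Finset.insert_subset_insert i h))
      (fun A B h => hg (Finset.insert_subset_insert i h))
    have a2 := ih hf hg
    have b1 : bexp s p f ≤ bexp s p (fun A => f (insert i A)) :=
      bexp_mono h0 h1 fun A _ => hf (Finset.subset_insert i A)
    have b2 : bexp s p g ≤ bexp s p (fun A => g (insert i A)) :=
      bexp_mono h0 h1 fun A _ => hg (Finset.subset_insert i A)
    generalize bexp s p (fun A => f (insert i A)) = x at *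
    generalize bexp s p (fun A => g (insert i A)) = y at *
    generalize bexp s p f = u at *
    generalize bexp s p g = v at *
    -- This is the covariance contributed by the single coordinate `i`.
    have c1 : 0 ≤ p * (1 - p) * ((x - u) * (y - v)) :=
      mul_nonneg (mul_nonneg h0 (by linarith)) (mul_nonneg (by linarith) (by linarith))
    have c2 := mul_le_mul_of_nonneg_left a1 h0
    have c3 := mul_le_mul_of_nonneg_left a2 (by linarith : 0 ≤ 1 - p)
    nlinarith

/-- The union of two independent Bernoulli subsets is a Bernoulli subset. -/
theorem bexp_bexp_union (s : Finset ι) (p q : ℝ) (f : Finset ι → ℝ) :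
    bexp s p (fun A => bexp s q (fun B => f (A ∪ B))) = bexp s (p + q - p * q) f := by
  induction s using Finset.induction_on generalizing f with
  | empty => simp [bexp_empty]
  | insert i s hi ih =>
    simp only [bexp_insert hi, Finset.insert_union, Finset.union_insert, Finset.insert_idem]
    simp only [bexp_add, bexp_mul_left]
    have h1 := ih (fun A => f (insert i A))
    have h2 := ih f
    simp only [h1, h2]
    ring

theorem bexp_subset {s D : Finset ι} (hD : D ⊆ s) (p : ℝ) :
    bexp s p (fun A => if D ⊆ A then 1 else 0) = p ^ D.card := by
  rw [bexp_restrict hD p]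
  · rw [bexp, Finset.sum_eq_single D]
    · simp
    · intro A hA hne
      have : ¬ D ⊆ A := fun h => hne (Finset.Subset.antisymm (Finset.mem_powerset.1 hA) h)
      simp [this]
    · simp
  · intro A _
    simp only [Finset.subset_inter_iff, Finset.Subset.refl, and_true]

theorem bexp_disjoint {s D : Finset ι} (hD : D ⊆ s) (p : ℝ) :
    bexp s p (fun A => if Disjoint A D then 1 else 0) = (1 - p) ^ D.card := by
  rw [bexp_restrict hD p]
  · rw [bexp, Finset.sum_eq_single ∅]
    · simp
    · intro A hA hne
      have : ¬ Disjoint A D := fun h => hne (by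
        have := Finset.disjoint_of_subset_right (Finset.mem_powerset.1 hA) h
        simpa using this)
      simp [this]
    · simp
  · intro A _
    have : Disjoint (A ∩ D) D ↔ Disjoint A D := by
      simp only [Finset.disjoint_iff_inter_eq_empty, Finset.inter_assoc, Finset.inter_self]
    simp only [this]

/-- If `D A ⊆ t` and `g A` only depend on the coordinates outside `t`, then conditionally on these
the probability that `A` avoids `D A` is `(1 - p) ^ |D A|`. -/
theorem bexp_mul_disjoint {s t : Finset ι} (hts : t ⊆ s) (p : ℝ) {g : Finset ι → ℝ}
    {D : Finset ι → Finset ι} (hDt : ∀ A ⊆ s, D A ⊆ t) (hD : ∀ A ⊆ s, D (A \ t) = D A)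
    (hg : ∀ A ⊆ s, g (A \ t) = g A) :
    bexp s p (fun A => g A * if Disjoint A (D A) then 1 else 0) =
      bexp s p (fun A => g A * (1 - p) ^ (D A).card) := by
  have hs : s = (s \ t) ∪ t := (Finset.sdiff_union_of_subset hts).symm
  have hd : Disjoint (s \ t) t := Finset.sdiff_disjoint
  rw [hs, bexp_union hd, bexp_union hd]
  refine bexp_congr fun A hA => ?_
  have hAs : A ⊆ s := hA.trans Finset.sdiff_subset
  have key : ∀ B ⊆ t, (A ∪ B) \ t = A := fun B hB => by
    rw [Finset.union_sdiff_distrib, Finset.sdiff_eq_empty_iff_subset.2 hB, Finset.union_empty,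
      Finset.sdiff_eq_self_of_disjoint (hd.mono_left hA)]
  have key2 : ∀ B ⊆ t, D (A ∪ B) = D A ∧ g (A ∪ B) = g A := fun B hB => by
    have h1 : A ∪ B ⊆ s := Finset.union_subset hAs (hB.trans hts)
    rw [← hD _ h1, ← hg _ h1, key B hB]; exact ⟨rfl, rfl⟩
  rw [bexp_congr (g := fun B => g A * if Disjoint B (D A) then 1 else 0), bexp_mul_left,
    bexp_disjoint (hDt A hAs), bexp_congr (g := fun _ => g A * (1 - p) ^ (D A).card), bexp_const]
  · intro B hB; rw [(key2 B hB).1, (key2 B hB).2]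
  · intro B hB
    rw [(key2 B hB).1, (key2 B hB).2]
    have : Disjoint A (D A) := (hd.mono_left hA).mono_right (hDt A hAs)
    simp only [Finset.disjoint_union_left, this, true_and]

/-- Decoupling: if the event `{c A = k}` is determined by the coordinates in `t k` and `h k` only
depends on the other coordinates, then `A` may be replaced by an independent copy in `h (c A) A`. -/
theorem bexp_decouple {κ : Type*} {s : Finset ι} (p : ℝ) (c : Finset ι → κ)
    (t : κ → Finset ι) (h : κ → Finset ι → ℝ)
    (hts : ∀ k, t k ⊆ s) (hc : ∀ A ⊆ s, ∀ k, c (A ∩ t k) = k ↔ c A = k)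
    (hh : ∀ A ⊆ s, ∀ k, h k (A \ t k) = h k A) :
    bexp s p (fun A => h (c A) A) = bexp s p (fun A => bexp s p (fun B => h (c A) B)) := by
  set K := s.powerset.image c with hK
  have hmem : ∀ A ⊆ s, c A ∈ K := fun A hA =>
    Finset.mem_image_of_mem _ (Finset.mem_powerset.2 hA)
  have e1 : bexp s p (fun A => h (c A) A) =
      bexp s p (fun A => ∑ k ∈ K, (if c A = k then 1 else 0) * h k A) :=
    bexp_congr fun A hA => by simp [hmem A hA]
  have e2 : bexp s p (fun A => bexp s p (fun B => h (c A) B)) =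
      bexp s p (fun A => ∑ k ∈ K, bexp s p (h k) * (if c A = k then 1 else 0)) :=
    bexp_congr fun A hA => by simp [hmem A hA]
  rw [e1, e2, bexp_sum, bexp_sum]
  refine Finset.sum_congr rfl fun k _ => ?_
  rw [bexp_mul_left, mul_comm,
    bexp_mul_of_disjoint (hts k) p (f := fun A => if c A = k then 1 else 0) (g := h k)]
  · intro A hA; simp only [hc A hA k]
  · intro A hA; exact hh A hA k

theorem bexp_map {κ : Type*} [DecidableEq κ] (e : ι ↪ κ) (s : Finset ι) (p : ℝ) (f : Finset κ → ℝ) :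
    bexp (s.map e) p f = bexp s p (fun A => f (A.map e)) := by
  induction s using Finset.induction_on generalizing f with
  | empty => simp [bexp_empty]
  | insert i s hi ih =>
    rw [Finset.map_insert, bexp_insert (by simpa using hi), bexp_insert hi, ih, ih]
    simp only [Finset.map_insert]

end BernoulliExpectation

section Indicator

open Classical

variable {ι : Type*} [DecidableEq ι]

/-- The indicator of a proposition, as a real number. -/
noncomputable def ind (P : Prop) : ℝ := if P then 1 else 0

theorem ind_true {P : Prop} (h : P) : ind P = 1 := if_pos h

theorem ind_false {P : Prop} (h : ¬ P) : ind P = 0 := if_neg h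

theorem ind_nonneg (P : Prop) : 0 ≤ ind P := by unfold ind; split_ifs <;> simp

theorem ind_le_one (P : Prop) : ind P ≤ 1 := by unfold ind; split_ifs <;> simp

theorem ind_mono {P Q : Prop} (h : P → Q) : ind P ≤ ind Q := by
  by_cases hP : P
  · rw [ind_true hP, ind_true (h hP)]
  · rw [ind_false hP]; exact ind_nonneg Q

theorem ind_congr {P Q : Prop} (h : P ↔ Q) : ind P = ind Q := by rw [propext h]

theorem ind_and (P Q : Prop) : ind (P ∧ Q) = ind P * ind Q := by
  by_cases hP : P <;> by_cases hQ : Q <;> simp [ind, hP, hQ]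

theorem bexp_ind_mono {s : Finset ι} {p : ℝ} (h0 : 0 ≤ p) (h1 : p ≤ 1)
    {P Q : Finset ι → Prop} (h : ∀ A ⊆ s, P A → Q A) :
    bexp s p (fun A => ind (P A)) ≤ bexp s p (fun A => ind (Q A)) :=
  bexp_mono h0 h1 fun A hA => ind_mono (h A hA)

theorem bexp_nonneg {s : Finset ι} {p : ℝ} (h0 : 0 ≤ p) (h1 : p ≤ 1) {f : Finset ι → ℝ}
    (h : ∀ A ⊆ s, 0 ≤ f A) : 0 ≤ bexp s p f :=
  le_bexp h0 h1 h

theorem bexp_ind_subset {s D : Finset ι} (hD : D ⊆ s) (p : ℝ) :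
    bexp s p (fun A => ind (D ⊆ A)) = p ^ D.card := by
  rw [← bexp_subset hD p]
  exact bexp_congr fun A _ => by unfold ind; congr

theorem bexp_ind_disjoint {s D : Finset ι} (hD : D ⊆ s) (p : ℝ) :
    bexp s p (fun A => ind (Disjoint A D)) = (1 - p) ^ D.card := by
  rw [← bexp_disjoint hD p]
  exact bexp_congr fun A _ => by unfold ind; congr

theorem bexp_mul_ind_disjoint {s t : Finset ι} (hts : t ⊆ s) (p : ℝ) {g : Finset ι → ℝ}
    {D : Finset ι → Finset ι} (hDt : ∀ A ⊆ s, D A ⊆ t) (hD : ∀ A ⊆ s, D (A \ t) = D A)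
    (hg : ∀ A ⊆ s, g (A \ t) = g A) :
    bexp s p (fun A => g A * ind (Disjoint A (D A))) =
      bexp s p (fun A => g A * (1 - p) ^ (D A).card) := by
  rw [← bexp_mul_disjoint hts p hDt hD hg]
  exact bexp_congr fun A _ => by unfold ind; congr

/-- Monotone coupling: level `q` is level `p` together with an independent layer at level `(q - p) /
(1 - p)`. -/
theorem bexp_ind_le_of_add {s : Finset ι} {p q : ℝ} (hp0 : 0 ≤ p) (hp1 : p ≤ 1)
    (hq1 : q ≤ 1) {f : Finset ι → ℝ} (hf : ∀ ⦃A B⦄, A ⊆ B → f B ≤ f A) (hpq : p ≤ q) :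
    bexp s q f ≤ bexp s p f := by
  rcases hp1.lt_or_eq with h | h
  · have hd : 0 < 1 - p := by linarith
    have e : q = p + (q - p) / (1 - p) - p * ((q - p) / (1 - p)) := by field_simp; ring
    have hr0 : 0 ≤ (q - p) / (1 - p) := div_nonneg (by linarith) hd.le
    have hr1 : (q - p) / (1 - p) ≤ 1 := by rw [div_le_one hd]; linarith
    rw [e, ← bexp_bexp_union]
    refine bexp_mono hp0 hp1 fun A _ => bexp_le hr0 hr1 fun B _ => hf Finset.subset_union_left
  · rw [show q = p by linarith]

end Indicator

/-! ### Clusters as smallest closed sets. -/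

section Cluster

variable {V : Type*}

/-- `Y` is a union of clusters of the configuration `A`. -/
def Closed (A : Set (Sym2 V)) (Y : Set V) : Prop :=
  ∀ u v, s(u, v) ∈ A → u ∈ Y → v ∈ Y

theorem Closed.mono {A B : Set (Sym2 V)} {Y : Set V} (h : Closed B Y) (hAB : A ⊆ B) :
    Closed A Y := fun u v huv hu => h u v (hAB huv) hu

theorem Closed.mem_iff {A : Set (Sym2 V)} {Y : Set V} (h : Closed A Y) {u v : V}
    (huv : s(u, v) ∈ A) : u ∈ Y ↔ v ∈ Y :=
  ⟨h u v huv, h v u (by rwa [Sym2.eq_swap])⟩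

theorem Closed.compl {A : Set (Sym2 V)} {Y : Set V} (h : Closed A Y) : Closed A Yᶜ :=
  fun _ _ huv hu hv => hu ((h.mem_iff huv).2 hv)

theorem subset_cluster (A : Set (Sym2 V)) (S : Set V) : S ⊆ cluster A S :=
  fun s hs => ⟨s, hs, SimpleGraph.Reachable.refl s⟩

theorem closed_cluster (A : Set (Sym2 V)) (S : Set V) : Closed A (cluster A S) := by
  rintro u v huv ⟨s, hs, hsu⟩
  by_cases h : u = v
  · exact h ▸ ⟨s, hs, hsu⟩
  · exact ⟨s, hs, hsu.trans (SimpleGraph.Adj.reachable (by simp [huv, h]))⟩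

/-- Minimality of the cluster among closed sets; this replaces arguments with paths throughout. -/
theorem cluster_subset {A : Set (Sym2 V)} {S Y : Set V} (hS : S ⊆ Y) (hY : Closed A Y) :
    cluster A S ⊆ Y := by
  rintro v ⟨s, hs, ⟨w⟩⟩
  have hs' := hS hs
  clear hs
  induction w with
  | nil => exact hs'
  | cons h w ih => exact ih (hY _ _ ((SimpleGraph.fromEdgeSet_adj _).1 h).1 hs')

theorem cluster_mono {A B : Set (Sym2 V)} {S T : Set V} (hAB : A ⊆ B) (hST : S ⊆ T) :
    cluster A S ⊆ cluster B T :=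
  cluster_subset (hST.trans (subset_cluster B T)) ((closed_cluster B T).mono hAB)

/-- Locality: a cluster is determined by the states of the edges meeting it. All later decouplings
rest on this. -/
theorem cluster_congr {A B : Set (Sym2 V)} {S : Set V}
    (h : ∀ u v, u ∈ cluster A S → (s(u, v) ∈ A ↔ s(u, v) ∈ B)) : cluster A S = cluster B S := by
  refine Set.Subset.antisymm ?_
    (cluster_subset (subset_cluster A S)
      fun u v huv hu => closed_cluster A S u v ((h u v hu).2 huv) hu)
  refine (cluster_subset (Y := cluster A S ∩ cluster B S) ?_ ?_).trans Set.inter_subset_right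
  · exact Set.subset_inter (subset_cluster A S) (subset_cluster B S)
  · rintro u v huv ⟨h1, h2⟩
    exact ⟨closed_cluster A S u v huv h1, closed_cluster B S u v ((h u v h1).1 huv) h2⟩

theorem cluster_union (A : Set (Sym2 V)) (S T : Set V) :
    cluster A (S ∪ T) = cluster A S ∪ cluster A T := by
  ext v; simp only [cluster, Set.mem_ofPred_eq, Set.mem_union, or_and_right, exists_or]

theorem cluster_empty (A : Set (Sym2 V)) : cluster A ∅ = ∅ := by
  ext v; simp [cluster]

end Cluster

/-! ### Confinement to a finite volume. -/

section Edges

open Classical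

variable {V : Type*} (G : SimpleGraph V) [G.LocallyFinite]

/-- The finite set of edges with at least one endpoint in `Λ`. -/
noncomputable def touching (Λ : Finset V) : Finset (Sym2 V) :=
  Λ.biUnion fun v => G.incidenceFinset v

variable {G}

theorem mem_touching {Λ : Finset V} {e : Sym2 V} :
    e ∈ touching G Λ ↔ e ∈ G.edgeSet ∧ ∃ v ∈ Λ, v ∈ e := by
  simp only [touching, Finset.mem_biUnion, SimpleGraph.mem_incidenceFinset]
  constructor
  · rintro ⟨v, hv, h⟩; exact ⟨h.1, v, hv, h.2⟩
  · rintro ⟨h, v, hv, hve⟩; exact ⟨v, hv, h, hve⟩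

theorem mk_mem_touching {Λ : Finset V} {u v : V} :
    s(u, v) ∈ touching G Λ ↔ G.Adj u v ∧ (u ∈ Λ ∨ v ∈ Λ) := by
  rw [mem_touching, SimpleGraph.mem_edgeSet]
  refine and_congr_right fun _ => ⟨?_, ?_⟩
  · rintro ⟨w, hw, h⟩
    rcases Sym2.mem_iff.1 h with rfl | rfl
    · exact Or.inl hw
    · exact Or.inr hw
  · rintro (h | h)
    · exact ⟨u, h, by simp⟩
    · exact ⟨v, h, by simp⟩

theorem touching_subset_edgeSet (Λ : Finset V) : (touching G Λ : Set (Sym2 V)) ⊆ G.edgeSet :=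
  fun _ he => (mem_touching.1 he).1

theorem touching_mono {Λ Λ' : Finset V} (h : Λ ⊆ Λ') : touching G Λ ⊆ touching G Λ' :=
  Finset.biUnion_subset_biUnion_of_subset_left _ h

theorem cluster_inter_touching {A : Set (Sym2 V)} (hA : A ⊆ G.edgeSet) {S : Set V}
    {Λ : Finset V} (h : cluster (A ∩ touching G Λ) S ⊆ Λ) :
    cluster (A ∩ touching G Λ) S = cluster A S := by
  refine cluster_congr fun u v hu => ⟨fun h => h.1, fun huv => ⟨huv, ?_⟩⟩
  exact mk_mem_touching.2 ⟨hA huv, Or.inl (h hu)⟩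

/-- Leaving `Λ` for the first time uses an edge touching `Λ`, so confinement is an event on finitely
many edges. -/
theorem cluster_inter_touching_subset_iff {A : Set (Sym2 V)} (hA : A ⊆ G.edgeSet) {S : Set V}
    {Λ : Finset V} : cluster (A ∩ touching G Λ) S ⊆ Λ ↔ cluster A S ⊆ Λ := by
  refine ⟨fun h => ?_, fun h => (cluster_mono Set.inter_subset_left subset_rfl).trans h⟩
  rwa [← cluster_inter_touching hA h]

variable (G) in
/-- The probability at level `p` that `S` is not connected to the complement of `Λ`. -/
noncomputable def probInside (p : ℝ) (S : Set V) (Λ : Finset V) : ℝ :=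
  bexp (touching G Λ) p fun A => ind (cluster (A : Set (Sym2 V)) S ⊆ Λ)

theorem probInside_eq {E Λ : Finset V} (h : Λ ⊆ E) (p : ℝ) (S : Set V) :
    bexp (touching G E) p (fun A => ind (cluster (A : Set (Sym2 V)) S ⊆ Λ)) =
      probInside G p S Λ := by
  refine bexp_restrict (touching_mono h) p fun A hA => ind_congr ?_
  rw [Finset.coe_inter]
  exact cluster_inter_touching_subset_iff fun e he => touching_subset_edgeSet E (hA he)

theorem probInside_nonneg {p : ℝ} (h0 : 0 ≤ p) (h1 : p ≤ 1)
    (S : Set V) (Λ : Finset V) : 0 ≤ probInside G p S Λ :=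
  bexp_nonneg h0 h1 fun _ _ => ind_nonneg _

theorem probInside_le_one {p : ℝ} (h0 : 0 ≤ p) (h1 : p ≤ 1)
    (S : Set V) (Λ : Finset V) : probInside G p S Λ ≤ 1 :=
  bexp_le h0 h1 fun _ _ => ind_le_one _

theorem probInside_mono {p : ℝ} (h0 : 0 ≤ p) (h1 : p ≤ 1)
    (S : Set V) {Λ Λ' : Finset V} (h : Λ ⊆ Λ') :
    probInside G p S Λ ≤ probInside G p S Λ' := by
  rw [← probInside_eq h]
  exact bexp_ind_mono h0 h1 fun A _ hA => hA.trans (by exact_mod_cast h)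

theorem probInside_anti {p : ℝ} (h0 : 0 ≤ p) (h1 : p ≤ 1)
    {S T : Set V} (h : S ⊆ T) (Λ : Finset V) :
    probInside G p T Λ ≤ probInside G p S Λ :=
  bexp_ind_mono h0 h1 fun _ _ hA => (cluster_mono subset_rfl h).trans hA

theorem probInside_level {p : ℝ} (h0 : 0 ≤ p) (h1 : p ≤ 1)
    {q : ℝ} (hpq : p ≤ q) (hq : q ≤ 1) (S : Set V) (Λ : Finset V) :
    probInside G q S Λ ≤ probInside G p S Λ := by
  refine bexp_ind_le_of_add h0 h1 hq (fun A B hAB => ind_mono fun h => ?_) hpq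
  exact (cluster_mono (by exact_mod_cast hAB) subset_rfl).trans h

end Edges

/-! ### Balls in the graph distance. -/

section Balls

open Classical

variable {V : Type*} (G : SimpleGraph V) [G.LocallyFinite]

/-- The ball of radius `r` around `x` in the graph distance. -/
noncomputable def ball (x : V) : ℕ → Finset V
  | 0 => {x}
  | r + 1 => ball x r ∪ (ball x r).biUnion fun v => G.neighborFinset v

variable {G}

theorem mem_ball_succ {x v : V} {r : ℕ} :
    v ∈ ball G x (r + 1) ↔ v ∈ ball G x r ∨ ∃ u ∈ ball G x r, G.Adj u v := by
  simp [ball]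

theorem mem_ball_zero {x v : V} : v ∈ ball G x 0 ↔ v = x := by simp [ball]

theorem ball_subset_succ (x : V) (r : ℕ) : ball G x r ⊆ ball G x (r + 1) :=
  Finset.subset_union_left

theorem ball_mono (x : V) {r s : ℕ} (h : r ≤ s) : ball G x r ⊆ ball G x s := by
  induction h with
  | refl => exact subset_rfl
  | step _ ih => exact ih.trans (ball_subset_succ x _)

theorem self_mem_ball (x : V) (r : ℕ) : x ∈ ball G x r :=
  ball_mono x (Nat.zero_le r) (mem_ball_zero.2 rfl)

theorem mem_ball_one_of_adj {x y : V} (h : G.Adj x y) : y ∈ ball G x 1 :=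
  mem_ball_succ.2 (Or.inr ⟨x, self_mem_ball x 0, h⟩)

theorem ball_trans {x y z : V} {r s : ℕ} (hy : y ∈ ball G x r) (hz : z ∈ ball G y s) :
    z ∈ ball G x (r + s) := by
  induction s generalizing z with
  | zero => rw [mem_ball_zero] at hz; exact hz ▸ hy
  | succ s ih =>
    rcases mem_ball_succ.1 hz with h | ⟨u, hu, huz⟩
    · exact ball_subset_succ _ _ (ih h)
    · exact mem_ball_succ.2 (Or.inr ⟨u, ih hu, huz⟩)

theorem ball_symm {x y : V} {r : ℕ} (h : y ∈ ball G x r) : x ∈ ball G y r := by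
  induction r generalizing y with
  | zero => rw [mem_ball_zero] at h ⊢; exact h.symm
  | succ r ih =>
    rcases mem_ball_succ.1 h with h | ⟨u, hu, huy⟩
    · exact ball_subset_succ _ _ (ih h)
    · rw [Nat.add_comm]
      exact ball_trans (mem_ball_one_of_adj huy.symm) (ih hu)

/-- A set containing a point of a ball and closed under the edges inside the ball contains the
whole ball. -/
theorem ball_subset_of_closed {x w : V} {r : ℕ} {Y : Set V} (hw : w ∈ ball G x r) (hwY : w ∈ Y)
    (hY : ∀ u ∈ ball G x r, ∀ v ∈ ball G x r, G.Adj u v → u ∈ Y → v ∈ Y) :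
    (ball G x r : Set V) ⊆ Y := by
  have hx : ∀ k ≤ r, ∀ v ∈ ball G x k, (v ∈ Y ↔ x ∈ Y) := by
    intro k hk
    induction k with
    | zero => intro v hv; rw [mem_ball_zero] at hv; rw [hv]
    | succ k ih =>
      intro v hv
      rcases mem_ball_succ.1 hv with h | ⟨u, hu, huv⟩
      · exact ih (by omega) v h
      · rw [← ih (by omega) u hu]
        have hu' := ball_mono x (by omega : k ≤ r) hu
        have hv' := ball_mono x hk hv
        exact ⟨hY v hv' u hu' huv.symm, hY u hu' v hv' huv⟩
  intro v hv
  exact (hx r le_rfl v hv).2 ((hx r le_rfl w hw).1 hwY)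

theorem exists_mem_ball (hG : G.Connected) (x v : V) : ∃ r, v ∈ ball G x r := by
  obtain ⟨w⟩ := hG.preconnected x v
  induction w with
  | nil => exact ⟨0, self_mem_ball _ _⟩
  | cons h w ih =>
    obtain ⟨r, hr⟩ := ih
    exact ⟨1 + r, ball_trans (mem_ball_one_of_adj h) hr⟩

theorem exists_subset_ball (hG : G.Connected) (x : V) (S : Finset V) : ∃ r, S ⊆ ball G x r := by
  induction S using Finset.induction_on with
  | empty => exact ⟨0, by simp⟩
  | insert v S _ ih =>
    obtain ⟨r, hr⟩ := ih
    obtain ⟨s, hs⟩ := exists_mem_ball hG x v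
    refine ⟨max r s, Finset.insert_subset (ball_mono x (le_max_right _ _) hs)
      (hr.trans (ball_mono x (le_max_left _ _)))⟩

theorem exists_far [Infinite V] (Λ : Finset V) (r : ℕ) : ∃ x, ∀ v ∈ Λ, v ∉ ball G x r := by
  obtain ⟨x, hx⟩ := Infinite.exists_notMem_finset (Λ.biUnion fun v => ball G v r)
  refine ⟨x, fun v hv h => hx (Finset.mem_biUnion.2 ⟨v, hv, ball_symm h⟩)⟩

theorem ball_map (φ : G ≃g G) (x : V) (r : ℕ) :
    ball G (φ x) r = (ball G x r).map φ.toEquiv.toEmbedding := by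
  have key : ∀ (φ : G ≃g G) (x v : V) (r : ℕ), v ∈ ball G x r → φ v ∈ ball G (φ x) r := by
    intro φ x v r hv
    induction r generalizing v with
    | zero => rw [mem_ball_zero] at hv ⊢; rw [hv]
    | succ r ih =>
      rcases mem_ball_succ.1 hv with h | ⟨u, hu, huv⟩
      · exact ball_subset_succ _ _ (ih v h)
      · exact mem_ball_succ.2 (Or.inr ⟨φ u, ih u hu, φ.map_adj_iff.2 huv⟩)
  ext v
  rw [Finset.mem_map]
  constructor
  · intro hv
    refine ⟨φ.symm v, ?_, by simp⟩
    have := key φ.symm _ _ _ hv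
    simpa using this
  · rintro ⟨u, hu, rfl⟩; exact key φ x u r hu

theorem card_ball (hG : IsTransitive G) (x y : V) (r : ℕ) :
    (ball G x r).card = (ball G y r).card := by
  obtain ⟨φ, rfl⟩ := hG x y
  rw [ball_map, Finset.card_map]

theorem degree_eq (hG : IsTransitive G) (x y : V) : G.degree x = G.degree y := by
  obtain ⟨φ, rfl⟩ := hG x y
  exact (φ.degree_eq x).symm

theorem disjoint_touching {Λ : Finset V} {x : V} {r : ℕ} (h : ∀ v ∈ Λ, v ∉ ball G x (r + 1)) :
    Disjoint (touching G Λ) (touching G (ball G x r)) := by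
  rw [Finset.disjoint_left]
  intro e
  induction e with | h u v
  rw [mk_mem_touching, mk_mem_touching]
  rintro ⟨huv, h1⟩ ⟨_, h2⟩
  rcases h1 with h1 | h1 <;> rcases h2 with h2 | h2
  · exact h _ h1 (ball_subset_succ x r h2)
  · exact h _ h1 (mem_ball_succ.2 (Or.inr ⟨v, h2, huv.symm⟩))
  · exact h _ h1 (mem_ball_succ.2 (Or.inr ⟨u, h2, huv⟩))
  · exact h _ h1 (ball_subset_succ x r h2)

end Balls

/-! ### Transitivity, and large balls are likely to reach infinity. -/

section Automorphisms

open Classical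

variable {V : Type*} {G : SimpleGraph V} [G.LocallyFinite]

/-- The action of a permutation of the vertices on edges. -/
def edgeMap (e : V ≃ V) : Sym2 V ↪ Sym2 V := ⟨Sym2.map e, Sym2.map.injective e.injective⟩

theorem mk_mem_map_edgeMap (e : V ≃ V) (A : Finset (Sym2 V)) (u v : V) :
    s(e u, e v) ∈ A.map (edgeMap e) ↔ s(u, v) ∈ A := by
  exact Finset.mem_map' (edgeMap e) (a := s(u, v))

theorem touching_map (φ : G ≃g G) (Λ : Finset V) :
    touching G (Λ.map φ.toEquiv.toEmbedding) = (touching G Λ).map (edgeMap φ.toEquiv) := by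
  ext e
  induction e with | h u v
  obtain ⟨u, rfl⟩ := φ.toEquiv.surjective u
  obtain ⟨v, rfl⟩ := φ.toEquiv.surjective v
  rw [mk_mem_map_edgeMap, mk_mem_touching, mk_mem_touching]
  have : G.Adj (φ.toEquiv u) (φ.toEquiv v) ↔ G.Adj u v := φ.map_adj_iff
  rw [this]
  refine and_congr_right fun _ => ?_
  rw [Finset.mem_map_equiv, Finset.mem_map_equiv, Equiv.symm_apply_apply, Equiv.symm_apply_apply]

theorem cluster_map (e : V ≃ V) (A : Finset (Sym2 V)) (S : Set V) :
    cluster (A.map (edgeMap e) : Set (Sym2 V)) (e '' S) = e '' cluster (A : Set (Sym2 V)) S := by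
  apply Set.Subset.antisymm
  · refine cluster_subset (Set.image_mono (subset_cluster _ _)) ?_
    rintro u v huv ⟨u, hu, rfl⟩
    obtain ⟨v, rfl⟩ := e.surjective v
    rw [Finset.mem_coe, mk_mem_map_edgeMap] at huv
    exact ⟨v, closed_cluster _ _ u v huv hu, rfl⟩
  · rw [Set.image_subset_iff]
    refine cluster_subset (fun s hs => subset_cluster _ _ ⟨s, hs, rfl⟩) ?_
    intro u v huv hu
    refine closed_cluster _ _ (e u) (e v) ?_ hu
    rw [Finset.mem_coe, mk_mem_map_edgeMap]; exact huv

theorem probInside_map (φ : G ≃g G) (p : ℝ) (S : Set V) (Λ : Finset V) :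
    probInside G p (φ.toEquiv '' S) (Λ.map φ.toEquiv.toEmbedding) = probInside G p S Λ := by
  unfold probInside
  rw [touching_map, bexp_map]
  refine bexp_congr fun A _ => ind_congr ?_
  rw [cluster_map, Finset.coe_map]
  exact Set.image_subset_image_iff φ.toEquiv.injective

theorem probInside_map_symm (φ : G ≃g G) (p : ℝ) (S : Set V) (Λ : Finset V) :
    probInside G p (φ.toEquiv '' S) Λ =
      probInside G p S (Λ.map φ.symm.toEquiv.toEmbedding) := by
  rw [← probInside_map φ p S]
  congr 1
  ext v
  rw [Finset.mem_map_equiv, Finset.mem_map_equiv]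
  change v ∈ Λ ↔ φ (φ.symm v) ∈ Λ
  rw [φ.apply_symm_apply]

/-- A bound on the probability that a set is not connected to infinity is invariant under
automorphisms. -/
theorem probInside_le_of_transitive (hG : IsTransitive G) {p c : ℝ} {o : V}
    (h : ∀ Λ, probInside G p {o} Λ ≤ c) (v : V) (Λ : Finset V) :
    probInside G p {v} Λ ≤ c := by
  obtain ⟨φ, rfl⟩ := hG o v
  have := probInside_map_symm φ p {o} Λ
  rw [Set.image_singleton] at this
  exact this.trans_le (h _)

theorem ind_and_le {P₁ P₂ Q₁ Q₂ : Prop} (h₁ : P₁ → Q₁) (h₂ : P₂ → Q₂) :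
    ind (Q₁ ∧ Q₂) ≤ ind P₁ * ind P₂ + ((ind Q₁ - ind P₁) + (ind Q₂ - ind P₂)) := by
  by_cases a : P₁ <;> by_cases b : P₂ <;> by_cases c : Q₁ <;> by_cases d : Q₂ <;>
    simp_all [ind]

/-- Up to error `ε` each, confinement of `S` and of `T` to `Λ` is confinement to `Λ₁` and `Λ₂`;
these two events depend on disjoint sets of edges. -/
theorem probInside_union_le {p : ℝ} (h0 : 0 ≤ p) (h1 : p ≤ 1) {S T : Set V}
    {Λ Λ₁ Λ₂ : Finset V} (hd : Disjoint (touching G Λ₁) (touching G Λ₂)) (hs₁ : Λ₁ ⊆ Λ)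
    (hs₂ : Λ₂ ⊆ Λ) {ε : ℝ} (he₁ : probInside G p S Λ ≤ probInside G p S Λ₁ + ε)
    (he₂ : probInside G p T Λ ≤ probInside G p T Λ₂ + ε) :
    probInside G p (S ∪ T) Λ ≤ probInside G p S Λ₁ * probInside G p T Λ₂ + 2 * ε := by
  have hprod : bexp (touching G Λ) p (fun A =>
      ind (cluster (A : Set (Sym2 V)) S ⊆ Λ₁) * ind (cluster (A : Set (Sym2 V)) T ⊆ Λ₂)) =
      probInside G p S Λ₁ * probInside G p T Λ₂ := by
    rw [← probInside_eq hs₁, ← probInside_eq hs₂,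
      bexp_mul_of_disjoint (touching_mono hs₁)]
    · intro A hA
      refine ind_congr ?_
      rw [Finset.coe_inter]
      exact cluster_inter_touching_subset_iff fun e he => touching_subset_edgeSet Λ (hA he)
    · intro A hA
      have hA' : (A : Set (Sym2 V)) ⊆ G.edgeSet := fun e he => touching_subset_edgeSet Λ (hA he)
      refine ind_congr ?_
      rw [← cluster_inter_touching_subset_iff hA',
        ← cluster_inter_touching_subset_iff (fun e he => hA' (Finset.sdiff_subset he)),
        ← Finset.coe_inter, ← Finset.coe_inter]
      have : (A \ touching G Λ₁) ∩ touching G Λ₂ = A ∩ touching G Λ₂ := by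
        ext e
        simp only [Finset.mem_inter, Finset.mem_sdiff]
        exact ⟨fun h => ⟨h.1.1, h.2⟩, fun h => ⟨⟨h.1, fun h' => Finset.disjoint_left.1 hd h' h.2⟩,
          h.2⟩⟩
      rw [this]
  have e₁ := probInside_eq (G := G) hs₁ p S
  have e₂ := probInside_eq (G := G) hs₂ p T
  have hmain : probInside G p (S ∪ T) Λ ≤ bexp (touching G Λ) p (fun A =>
      ind (cluster (A : Set (Sym2 V)) S ⊆ Λ₁) * ind (cluster (A : Set (Sym2 V)) T ⊆ Λ₂) +
        ((ind (cluster (A : Set (Sym2 V)) S ⊆ Λ) - ind (cluster (A : Set (Sym2 V)) S ⊆ Λ₁)) +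
        (ind (cluster (A : Set (Sym2 V)) T ⊆ Λ) - ind (cluster (A : Set (Sym2 V)) T ⊆ Λ₂)))) := by
    refine bexp_mono h0 h1 fun A _ => ?_
    have m₁ : cluster (A : Set (Sym2 V)) S ⊆ Λ₁ → cluster (A : Set (Sym2 V)) S ⊆ Λ :=
      fun h => h.trans (by exact_mod_cast hs₁)
    have m₂ : cluster (A : Set (Sym2 V)) T ⊆ Λ₂ → cluster (A : Set (Sym2 V)) T ⊆ Λ :=
      fun h => h.trans (by exact_mod_cast hs₂)
    rw [cluster_union, Set.union_subset_iff]
    exact ind_and_le m₁ m₂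
  rw [bexp_add, bexp_add, bexp_sub, bexp_sub, hprod, e₁, e₂] at hmain
  unfold probInside at he₁ he₂ hmain ⊢
  linarith

/-- The supremum over `Λ` plays the role of the probability of a finite cluster, so some finite
volume nearly attains it. -/
theorem exists_probInside_almost_max {p : ℝ} (h0 : 0 ≤ p) (h1 : p ≤ 1) (S : Set V) {ε : ℝ}
    (hε : 0 < ε) : ∃ Λ₀, ∀ Λ, probInside G p S Λ ≤ probInside G p S Λ₀ + ε := by
  have hb : BddAbove (Set.range fun Λ => probInside G p S Λ) :=
    ⟨1, by rintro _ ⟨Λ, rfl⟩; exact probInside_le_one h0 h1 S Λ⟩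
  obtain ⟨_, ⟨Λ₀, rfl⟩, h⟩ := exists_lt_of_lt_csSup
    (Set.range_nonempty fun Λ => probInside G p S Λ) (sub_lt_self _ hε)
  refine ⟨Λ₀, fun Λ => ?_⟩
  have := le_csSup hb ⟨Λ, rfl⟩
  simp only at h this
  linarith

/-- Large finite sets are unlikely to be disconnected from infinity. -/
theorem exists_finset_probInside_le [Infinite V] (hc : G.Connected) (hG : IsTransitive G)
    {p θ : ℝ} (h0 : 0 ≤ p) (h1 : p ≤ 1) (hθ : 0 < θ) {o : V}
    (h : ∀ Λ, probInside G p {o} Λ ≤ 1 - θ) (k : ℕ) :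
    ∃ S : Finset V, ∀ Λ, probInside G p S Λ ≤ (1 - θ / 2) ^ k := by
  have hθ1 : θ ≤ 1 := by
    linarith [probInside_nonneg (G := G) h0 h1 ({o} : Set V) (∅ : Finset V), h ∅]
  induction k with
  | zero => exact ⟨∅, fun Λ => by simpa using probInside_le_one h0 h1 _ Λ⟩
  | succ k ih =>
    obtain ⟨S, hS⟩ := ih
    set a := (1 - θ / 2) ^ k with ha
    have ha0 : 0 < a := pow_pos (by linarith) k
    -- Adding a far translate of `o` gives at most `a * (1 - θ) + 2 * (θ * a / 4) = a * (1 - θ /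
    -- 2)`.
    have hε : 0 < θ * a / 4 := by positivity
    obtain ⟨Λ₁, hΛ₁⟩ := exists_probInside_almost_max (G := G) h0 h1 (S : Set V) hε
    obtain ⟨Λ₂, hΛ₂⟩ := exists_probInside_almost_max (G := G) h0 h1 ({o} : Set V) hε
    obtain ⟨r, hr⟩ := exists_subset_ball hc o Λ₂
    obtain ⟨x, hx⟩ := exists_far (G := G) Λ₁ (r + 1)
    obtain ⟨φ, rfl⟩ := hG o x
    have hd : Disjoint (touching G Λ₁) (touching G (Λ₂.map φ.toEquiv.toEmbedding)) := by
      refine (disjoint_touching hx).mono_right (touching_mono ?_)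
      rw [ball_map]
      exact Finset.map_subset_map.2 hr
    have hφ : ∀ Λ, probInside G p {φ o} Λ ≤
        probInside G p {φ o} (Λ₂.map φ.toEquiv.toEmbedding) + θ * a / 4 := by
      intro Λ
      have e1 := probInside_map_symm φ p {o} Λ
      have e2 := probInside_map φ p {o} Λ₂
      rw [Set.image_singleton] at e1 e2
      change probInside G p {φ o} Λ = _ at e1
      change probInside G p {φ o} _ = _ at e2
      rw [e1, e2]; exact hΛ₂ _
    refine ⟨S ∪ {φ o}, fun Λ => ?_⟩
    set Λ' := Λ ∪ (Λ₁ ∪ Λ₂.map φ.toEquiv.toEmbedding) with hΛ'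
    have m1 : Λ₁ ⊆ Λ' := Finset.subset_union_left.trans Finset.subset_union_right
    have m2 : Λ₂.map φ.toEquiv.toEmbedding ⊆ Λ' :=
      Finset.subset_union_right.trans Finset.subset_union_right
    have key := probInside_union_le h0 h1 hd m1 m2 (hΛ₁ Λ') (hφ Λ')
    have hmono := probInside_mono (G := G) h0 h1 ((S : Set V) ∪ {φ o})
      (Finset.subset_union_left : Λ ⊆ Λ')
    have b1 := probInside_le_of_transitive hG h (φ o) (Λ₂.map φ.toEquiv.toEmbedding)
    have b2 := mul_le_mul (hS Λ₁) b1 (probInside_nonneg h0 h1 {φ o} _) ha0.le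
    rw [Finset.coe_union, Finset.coe_singleton, pow_succ]
    linarith

/-- Large balls are unlikely to be disconnected from infinity, uniformly in the centre. -/
theorem exists_ball_probInside_le [Infinite V] (hc : G.Connected) (hG : IsTransitive G)
    {p θ : ℝ} (h0 : 0 ≤ p) (h1 : p ≤ 1) (hθ : 0 < θ) {o : V}
    (h : ∀ Λ, probInside G p {o} Λ ≤ 1 - θ) {η : ℝ} (hη : 0 < η) :
    ∃ m, ∀ z Λ, probInside G p (ball G z m) Λ ≤ η := by
  have hθ1 : θ ≤ 1 := by
    linarith [probInside_nonneg (G := G) h0 h1 ({o} : Set V) (∅ : Finset V), h ∅]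
  obtain ⟨k, hk⟩ := exists_pow_lt_of_lt_one hη (by linarith : 1 - θ / 2 < 1)
  obtain ⟨S, hS⟩ := exists_finset_probInside_le hc hG h0 h1 hθ h k
  obtain ⟨m, hm⟩ := exists_subset_ball hc o S
  refine ⟨m, fun z Λ => ?_⟩
  obtain ⟨φ, rfl⟩ := hG o z
  rw [ball_map, Finset.coe_map]
  refine (probInside_map_symm φ p _ Λ).trans_le (le_trans ?_ hk.le)
  exact (probInside_anti h0 h1 (by exact_mod_cast hm) _).trans (hS _)

end Automorphisms

/-! ### Labelled explorations and how labels merge. -/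

section Exploration

open Classical

variable {V : Type*} (G : SimpleGraph V) [G.LocallyFinite]

/-- The finite set of edges with both endpoints in `Z`. -/
noncomputable def inner (Z : Finset V) : Finset (Sym2 V) :=
  (touching G Z).filter fun e => ∀ v ∈ e, v ∈ Z

/-- The edges inside the balls of radius `R` with centres in `W`. -/
noncomputable def ballEdges (R : ℕ) (W : Finset V) : Finset (Sym2 V) :=
  W.biUnion fun w => inner G (ball G w R)

variable {G}

theorem mk_mem_inner {Z : Finset V} {u v : V} :
    s(u, v) ∈ inner G Z ↔ G.Adj u v ∧ u ∈ Z ∧ v ∈ Z := by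
  simp only [inner, Finset.mem_filter, mk_mem_touching, Sym2.mem_iff, forall_eq_or_imp, forall_eq]
  tauto

theorem inner_subset_touching (Z : Finset V) : inner G Z ⊆ touching G Z :=
  Finset.filter_subset _ _

theorem inner_mono {Z Z' : Finset V} (h : Z ⊆ Z') : inner G Z ⊆ inner G Z' := by
  intro e
  induction e with | h u v
  rw [mk_mem_inner, mk_mem_inner]
  exact fun ⟨a, b, c⟩ => ⟨a, h b, h c⟩

variable (G) in
/-- `Y` witnesses that the vertices of label `1` are not connected to the vertices of label `0`,
when the vertices outside `Z` are identified according to their labels, and one uses the edges of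
`A₁` inside `Z`, the edges of `A₂` touching `Z`, and the edges of `A₃` outside of the balls with
centres in `W`. -/
structure Separates (R : ℕ) (Z : Finset V) (τ : V → ℕ) (W : Finset V)
    (A₁ A₂ A₃ : Finset (Sym2 V)) (Y : Set V) : Prop where
  one : ∀ v ∉ Z, τ v = 1 → v ∈ Y
  zero : ∀ v ∉ Z, τ v = 0 → v ∉ Y
  label : ∀ u ∉ Z, ∀ v ∉ Z, τ u = τ v → u ∈ Y → v ∈ Y
  closed₁ : Closed (↑(A₁ ∩ inner G Z)) Y
  closed₂ : Closed (↑(A₂ ∩ touching G Z)) Y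
  closed₃ : Closed (↑(A₃ \ ballEdges G R W)) Y

/-- The invariants of the labelling: `Z` is the unlabelled part of `Λ`, the set `S` has label `1`,
the outside of `Λ` has label `0`, and the other labels belong to `O`. -/
structure Labelled (Λ : Finset V) (S : Set V) (Z : Finset V) (τ : V → ℕ) (O : Finset ℕ) :
    Prop where
  sub : Z ⊆ Λ
  mem : ∀ v ∉ Z, τ v = 0 ∨ τ v = 1 ∨ τ v ∈ O
  zero : 0 ∉ O
  one : 1 ∉ O
  out : ∀ v ∉ Λ, τ v = 0
  src : ∀ v ∈ S, v ∉ Z ∧ τ v = 1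

variable (G) in
/-- The part of `Z` that is connected inside `Z` to `B`. -/
def explored (Z B : Finset V) (A₁ : Finset (Sym2 V)) : Set V :=
  cluster (↑(A₁ ∩ inner G Z)) (B ∩ Z)

/-- The labelled vertices which belong to `B` or are adjacent to `C`. -/
def touched (Z B : Finset V) (C : Set V) (A₂ : Finset (Sym2 V)) : Set V :=
  {w | w ∉ Z ∧ (w ∈ B ∨ ∃ u ∈ C, s(u, w) ∈ A₂)}

theorem explored_subset (Z B : Finset V) (A₁ : Finset (Sym2 V)) : explored G Z B A₁ ⊆ Z := by
  refine cluster_subset Set.inter_subset_right fun u v huv _ => ?_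
  rw [Finset.mem_coe, Finset.mem_inter, mk_mem_inner] at huv
  exact huv.2.2.2

theorem explored_mono {Z B B' : Finset V} {A A' : Finset (Sym2 V)} (hB : B ⊆ B') (hA : A ⊆ A') :
    explored G Z B A ⊆ explored G Z B' A' :=
  cluster_mono (by exact_mod_cast Finset.inter_subset_inter_right hA)
    (Set.inter_subset_inter_left _ (by exact_mod_cast hB))

theorem touched_mono {Z B B' : Finset V} {C C' : Set V} {A A' : Finset (Sym2 V)} (hB : B ⊆ B')
    (hC : C ⊆ C') (hA : A ⊆ A') : touched Z B C A ⊆ touched Z B' C' A' := by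
  rintro w ⟨h1, h2⟩
  refine ⟨h1, ?_⟩
  rcases h2 with h2 | ⟨u, hu, h2⟩
  · exact Or.inl (hB h2)
  · exact Or.inr ⟨u, hC hu, hA h2⟩

/-- Absorb `C` and all vertices of label `j` into the label `l`. -/
noncomputable def relabel (τ : V → ℕ) (C : Set V) (l j : ℕ) (v : V) : ℕ :=
  if v ∈ C ∨ τ v = j then l else τ v

/-- Since `Y` is constant on `C` and `T`, giving `C` a touched label `l` and merging a touched label
`j` into `l` creates no conflict. The alternative in `hlj` is a fresh label for `C` alone. -/
theorem Separates.relabel {R : ℕ} {Z : Finset V} {τ : V → ℕ} {W : Finset V}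
    {A₁ A₂ A₃ : Finset (Sym2 V)} {Y : Set V} (h : Separates G R Z τ W A₁ A₂ A₃ Y)
    {C T : Set V} (hT : T ⊆ (Z : Set V)ᶜ) {b : Prop} (hCb : ∀ v ∈ C, v ∈ Y ↔ b)
    (hTb : ∀ v ∈ T, v ∈ Y ↔ b) {l j : ℕ}
    (hlj : ((∃ w ∈ T, τ w = l) ∧ ∃ w ∈ T, τ w = j) ∨
      (j = l ∧ l ≠ 0 ∧ l ≠ 1 ∧ ∀ w ∉ Z, τ w ≠ l)) :
    Separates G R (Z.filter (· ∉ C)) (relabel τ C l j) W A₁ A₂ A₃ Y := by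
  have hlab : ∀ w ∈ T, ∀ v ∉ Z, τ v = τ w → (v ∈ Y ↔ b) := fun w hw v hv hvw => by
    rw [← hTb w hw]
    exact ⟨h.label v hv w (hT hw) hvw, h.label w (hT hw) v hv hvw.symm⟩
  have hZ : ∀ v, v ∉ Z.filter (· ∉ C) → v ∉ C → v ∉ Z := fun v hv hvC hvZ =>
    hv (Finset.mem_filter.2 ⟨hvZ, hvC⟩)
  have key : ∀ v, v ∉ Z.filter (· ∉ C) → Percolation.relabel τ C l j v = l → (v ∈ Y ↔ b) := by
    intro v hv hvl
    by_cases hvC : v ∈ C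
    · exact hCb v hvC
    have hvZ := hZ v hv hvC
    rcases hlj with ⟨⟨w, hw, hwl⟩, w', hw', hwj⟩ | ⟨rfl, -, -, hl⟩
    · by_cases hj : τ v = j
      · exact hlab w' hw' v hvZ (hj.trans hwj.symm)
      · rw [Percolation.relabel, if_neg (by simp [hvC, hj])] at hvl
        exact hlab w hw v hvZ (hvl.trans hwl.symm)
    · have := hl v hvZ
      rw [Percolation.relabel, if_neg (by simp [hvC, this])] at hvl
      exact absurd hvl this
  have key' : ∀ v, v ∉ Z.filter (· ∉ C) → Percolation.relabel τ C l j v ≠ l →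
      v ∉ Z ∧ Percolation.relabel τ C l j v = τ v := by
    intro v hv hvl
    unfold Percolation.relabel at hvl ⊢
    by_cases h' : v ∈ C ∨ τ v = j
    · rw [if_pos h'] at hvl; exact absurd rfl hvl
    · rw [if_neg h']
      exact ⟨hZ v hv fun hC => h' (Or.inl hC), rfl⟩
  refine ⟨fun v hv hv1 => ?_, fun v hv hv0 => ?_, fun u hu v hv huv huY => ?_, ?_, ?_, h.closed₃⟩
  · by_cases hl : Percolation.relabel τ C l j v = l
    · rw [key v hv hl]
      rcases hlj with ⟨⟨w, hw, hwl⟩, -⟩ | ⟨-, -, hl1, -⟩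
      · exact (hTb w hw).1 (h.one w (hT hw) (hwl.trans (hl.symm.trans hv1)))
      · exact absurd (hl.symm.trans hv1) hl1
    · obtain ⟨hvZ, e⟩ := key' v hv hl
      exact h.one v hvZ (e.symm.trans hv1)
  · by_cases hl : Percolation.relabel τ C l j v = l
    · rw [key v hv hl]
      rcases hlj with ⟨⟨w, hw, hwl⟩, -⟩ | ⟨-, hl0, -, -⟩
      · exact fun hb => h.zero w (hT hw) (hwl.trans (hl.symm.trans hv0)) ((hTb w hw).2 hb)
      · exact absurd (hl.symm.trans hv0) hl0
    · obtain ⟨hvZ, e⟩ := key' v hv hl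
      exact h.zero v hvZ (e.symm.trans hv0)
  · by_cases hl : Percolation.relabel τ C l j u = l
    · exact (key v hv (huv.symm.trans hl)).2 ((key u hu hl).1 huY)
    · obtain ⟨huZ, e⟩ := key' u hu hl
      obtain ⟨hvZ, e'⟩ := key' v hv (huv ▸ hl)
      exact h.label u huZ v hvZ (e.symm.trans (huv.trans e')) huY
  · exact h.closed₁.mono (by
      exact_mod_cast Finset.inter_subset_inter_left (inner_mono (Finset.filter_subset _ _)))
  · exact h.closed₂.mono (by
      exact_mod_cast Finset.inter_subset_inter_left (touching_mono (Finset.filter_subset _ _)))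

/-- The choice `j = l` means that no labels are merged; otherwise `j` must not be `0` or `1`, so
that the outside of `Λ` and `S` keep their labels. -/
theorem Labelled.relabel {Λ : Finset V} {S : Set V} {Z : Finset V} {τ : V → ℕ} {O : Finset ℕ}
    (h : Labelled Λ S Z τ O) {C : Set V} (hC : C ⊆ Z) {l j : ℕ} {O' : Finset ℕ}
    (hO : ∀ i ∈ O, i ≠ j → i ∈ O') (h0 : 0 ∉ O') (h1 : 1 ∉ O') (hl : l = 0 ∨ l = 1 ∨ l ∈ O')
    (hj : j = l ∨ (j ≠ 0 ∧ j ≠ 1)) :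
    Labelled Λ S (Z.filter (· ∉ C)) (relabel τ C l j) O' := by
  refine ⟨(Finset.filter_subset _ _).trans h.sub, fun v hv => ?_, h0, h1, fun v hv => ?_,
    fun v hv => ?_⟩
  · unfold Percolation.relabel
    split_ifs with h'
    · exact hl
    · push Not at h'
      have hvZ : v ∉ Z := fun hvZ => hv (Finset.mem_filter.2 ⟨hvZ, h'.1⟩)
      rcases h.mem v hvZ with h2 | h2 | h2
      · exact Or.inl h2
      · exact Or.inr (Or.inl h2)
      · exact Or.inr (Or.inr (hO _ h2 h'.2))
  · have hvC : v ∉ C := fun hvC => hv (h.sub (hC hvC))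
    have := h.out v hv
    unfold Percolation.relabel
    simp only [hvC, this, false_or]
    split_ifs with h'
    · rcases hj with hj | hj
      · rw [← hj, h']
      · exact absurd h'.symm hj.1
    · rfl
  · obtain ⟨hvZ, hv1⟩ := h.src v hv
    have hvC : v ∉ C := fun hvC => hvZ (hC hvC)
    refine ⟨fun h' => hvZ (Finset.filter_subset _ _ h'), ?_⟩
    unfold Percolation.relabel
    simp only [hvC, hv1, false_or]
    split_ifs with h'
    · rcases hj with hj | hj
      · rw [← hj, h']
      · exact absurd h'.symm hj.2
    · rfl

/-- The effect of one exploration step on the labels. The number of labels decreases if the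
explored set touches label `0` and another label, and increases only if it touches no label. -/
theorem Labelled.exists_step {Λ : Finset V} {S : Set V} {Z : Finset V} {τ : V → ℕ} {O : Finset ℕ}
    (h : Labelled Λ S Z τ O) {C T : Set V} (hC : C ⊆ Z) (hT : T ⊆ (Z : Set V)ᶜ) :
    ∃ (τ' : V → ℕ) (O' : Finset ℕ), Labelled Λ S (Z.filter (· ∉ C)) τ' O' ∧
      (¬ ((∃ w ∈ T, τ w = 0) ∧ ∃ w ∈ T, τ w = 1) →
        ∀ (R : ℕ) (W : Finset V) (A₁ A₂ A₃ : Finset (Sym2 V)) (Y : Set V) (b : Prop),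
          Separates G R Z τ W A₁ A₂ A₃ Y → (∀ v ∈ C, v ∈ Y ↔ b) → (∀ v ∈ T, v ∈ Y ↔ b) →
          Separates G R (Z.filter (· ∉ C)) τ' W A₁ A₂ A₃ Y) ∧
      ind (¬ ((∃ w ∈ T, τ w = 0) ∧ ∃ w ∈ T, τ w = 1)) * 2 ^ O'.card ≤
        2 ^ O.card * (1 - ind ((∃ w ∈ T, τ w = 0) ∧ ∃ w ∈ T, τ w ≠ 0) / 2 +
          ind (¬ T.Nonempty)) := by
  have hpos : (0 : ℝ) < 2 ^ O.card := by positivity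
  by_cases t0 : ∃ w ∈ T, τ w = 0
  · have hne : T.Nonempty := t0.imp fun _ hw => hw.1
    by_cases t1 : ∃ w ∈ T, τ w ≠ 0
    -- Labels `0` and `1` become connected, so the weight on the left vanishes and any labelling
    -- will do.
    · by_cases bad : ∃ w ∈ T, τ w = 1
      · refine ⟨_, O, h.relabel hC (l := 0) (j := 0) (fun i hi _ => hi) h.zero h.one (Or.inl rfl)
          (Or.inl rfl), fun hb => absurd ⟨t0, bad⟩ hb, ?_⟩
        rw [ind_false (by simp [t0, bad]), ind_true ⟨t0, t1⟩, ind_false (by simpa using hne)]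
        linarith
      · obtain ⟨w, hw, hw0⟩ := t1
        have hwO : τ w ∈ O := by
          rcases h.mem w (hT hw) with h' | h' | h'
          · exact absurd h' hw0
          · exact absurd ⟨w, hw, h'⟩ bad
          · exact h'
        refine ⟨_, O.erase (τ w), h.relabel hC (l := 0) (j := τ w)
          (fun i hi hij => Finset.mem_erase.2 ⟨hij, hi⟩)
          (fun h' => h.zero (Finset.mem_of_mem_erase h'))
          (fun h' => h.one (Finset.mem_of_mem_erase h')) (Or.inl rfl)
          (Or.inr ⟨hw0, fun h' => bad ⟨w, hw, h'⟩⟩), ?_, ?_⟩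
        · intro _ R W A₁ A₂ A₃ Y b hs hCb hTb
          exact hs.relabel hT hCb hTb (Or.inl ⟨t0, w, hw, rfl⟩)
        · rw [ind_true (by simp [bad]), ind_true ⟨t0, w, hw, hw0⟩, ind_false (by simpa using hne),
            ← Finset.card_erase_add_one hwO, pow_succ]
          linarith
    · refine ⟨_, O, h.relabel hC (l := 0) (j := 0) (fun i hi _ => hi) h.zero h.one (Or.inl rfl)
          (Or.inl rfl), ?_, ?_⟩
      · intro _ R W A₁ A₂ A₃ Y b hs hCb hTb
        exact hs.relabel hT hCb hTb (Or.inl ⟨t0, t0⟩)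
      · rw [ind_false (P := _ ∧ ∃ w ∈ T, τ w ≠ 0) (fun h' => t1 h'.2),
          ind_false (P := ¬ T.Nonempty) (by simpa using hne)]
        have := ind_le_one (¬ ((∃ w ∈ T, τ w = 0) ∧ ∃ w ∈ T, τ w = 1))
        nlinarith
  -- Without label `0` it suffices to join `C` to one touched label; further merging is not needed
  -- for the bound.
  · by_cases hne : T.Nonempty
    · obtain ⟨w, hw⟩ := hne
      refine ⟨_, O, h.relabel hC (l := τ w) (j := τ w) (fun i hi _ => hi) h.zero h.one
        (h.mem w (hT hw)) (Or.inl rfl), ?_, ?_⟩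
      · intro _ R W A₁ A₂ A₃ Y b hs hCb hTb
        exact hs.relabel hT hCb hTb (Or.inl ⟨⟨w, hw, rfl⟩, w, hw, rfl⟩)
      · rw [ind_true (fun h' => t0 h'.1), ind_false (P := _ ∧ ∃ w ∈ T, τ w ≠ 0) (fun h' => t0 h'.1),
          ind_false (P := ¬ T.Nonempty) (fun h' => h' ⟨w, hw⟩)]
        linarith
    -- Nothing is touched: `C` receives a fresh label, which doubles the weight.
    · obtain ⟨k, hk⟩ := Infinite.exists_notMem_finset (insert 0 (insert 1 O))
      simp only [Finset.mem_insert, not_or] at hk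
      refine ⟨_, insert k O, h.relabel hC (l := k) (j := k)
        (fun i hi _ => Finset.mem_insert_of_mem hi) ?_ ?_
        (Or.inr (Or.inr (Finset.mem_insert_self _ _))) (Or.inl rfl), ?_, ?_⟩
      · simp [h.zero, Ne.symm hk.1]
      · simp [h.one, Ne.symm hk.2.1]
      · intro _ R W A₁ A₂ A₃ Y b hs hCb hTb
        refine hs.relabel hT hCb hTb (Or.inr ⟨rfl, hk.1, hk.2.1, fun v hv hvk => ?_⟩)
        rcases h.mem v hv with h' | h' | h'
        · exact hk.1 (hvk.symm.trans h')
        · exact hk.2.1 (hvk.symm.trans h')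
        · exact hk.2.2 (hvk ▸ h')
      · rw [ind_true (fun h' => t0 h'.1), ind_false (P := _ ∧ ∃ w ∈ T, τ w ≠ 0) (fun h' => t0 h'.1),
          ind_true (P := ¬ T.Nonempty) hne, Finset.card_insert_of_notMem hk.2.2, pow_succ]
        linarith

end Exploration

/-! ### One exploration step and the resampling of unrevealed edges. -/

section ExplorationStep

open Classical

variable {V : Type*} (G : SimpleGraph V) [G.LocallyFinite]

/-- The edges from `C` to the complement of `Z`. -/
noncomputable def outEdges (Z : Finset V) (C : Set V) : Finset (Sym2 V) :=
  (touching G Z).filter fun e => ∃ u v, e = s(u, v) ∧ u ∈ C ∧ v ∉ Z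

/-- The edges inside `Z` with an endpoint in `C`. -/
noncomputable def innerTouching (Z : Finset V) (C : Set V) : Finset (Sym2 V) :=
  (inner G Z).filter fun e => ∃ v ∈ e, v ∈ C

/-- The probability that labels `0` and `1` are not connected, see `Separates`. -/
noncomputable def sepProb (Λ : Finset V) (R : ℕ) (p q r : ℝ) (Z : Finset V) (τ : V → ℕ)
    (W : Finset V) : ℝ :=
  bexp (touching G Λ) p fun A₁ => bexp (touching G Λ) q fun A₂ => bexp (touching G Λ) r fun A₃ =>
    ind (∃ Y, Separates G R Z τ W A₁ A₂ A₃ Y)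

variable {G}

theorem Separates.congr {R : ℕ} {Z : Finset V} {τ : V → ℕ} {W : Finset V}
    {A₁ A₂ A₃ A₁' A₂' A₃' : Finset (Sym2 V)} {Y : Set V} (h : Separates G R Z τ W A₁ A₂ A₃ Y)
    (h₁ : A₁ ∩ inner G Z = A₁' ∩ inner G Z) (h₂ : A₂ ∩ touching G Z = A₂' ∩ touching G Z)
    (h₃ : A₃ \ ballEdges G R W = A₃' \ ballEdges G R W) :
    Separates G R Z τ W A₁' A₂' A₃' Y :=
  ⟨h.one, h.zero, h.label, h₁ ▸ h.closed₁, h₂ ▸ h.closed₂, h₃ ▸ h.closed₃⟩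

theorem ind_separates_congr {R : ℕ} {Z : Finset V} {τ : V → ℕ} {W : Finset V}
    {A₁ A₂ A₃ A₁' A₂' A₃' : Finset (Sym2 V)}
    (h₁ : A₁ ∩ inner G Z = A₁' ∩ inner G Z) (h₂ : A₂ ∩ touching G Z = A₂' ∩ touching G Z)
    (h₃ : A₃ \ ballEdges G R W = A₃' \ ballEdges G R W) :
    ind (∃ Y, Separates G R Z τ W A₁ A₂ A₃ Y) = ind (∃ Y, Separates G R Z τ W A₁' A₂' A₃' Y) :=
  ind_congr (exists_congr fun _ => ⟨fun h => h.congr h₁ h₂ h₃,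
    fun h => h.congr h₁.symm h₂.symm h₃.symm⟩)

theorem sdiff_inter_of_disjoint {α : Type*} [DecidableEq α] {A s t : Finset α}
    (h : Disjoint s t) : (A \ s) ∩ t = A ∩ t := by
  ext e
  simp only [Finset.mem_inter, Finset.mem_sdiff]
  exact ⟨fun h' => ⟨h'.1.1, h'.2⟩, fun h' => ⟨⟨h'.1, fun hs => Finset.disjoint_left.1 h hs h'.2⟩,
    h'.2⟩⟩

/-- After a step, the `A₂` edges already revealed are not used by the new unexplored set `Z \ C`.
The next lemma says the same for `A₁`. -/
theorem disjoint_outEdges (Z : Finset V) (C : Set V) :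
    Disjoint (outEdges G Z C) (touching G (Z.filter (· ∉ C))) := by
  rw [Finset.disjoint_left]
  intro e he he'
  obtain ⟨-, u, v, rfl, hu, hv⟩ := Finset.mem_filter.1 he
  rcases (mk_mem_touching.1 he').2 with h | h
  · exact (Finset.mem_filter.1 h).2 hu
  · exact hv (Finset.mem_filter.1 h).1

theorem disjoint_innerTouching (Z : Finset V) (C : Set V) :
    Disjoint (innerTouching G Z C) (inner G (Z.filter (· ∉ C))) := by
  rw [Finset.disjoint_left]
  intro e he he'
  obtain ⟨-, v, hv, hvC⟩ := Finset.mem_filter.1 he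
  exact (Finset.mem_filter.1 ((Finset.mem_filter.1 he').2 v hv)).2 hvC

/-- The event that the explored set is `C` reveals only the edges inside `Z` that meet `C`; this is
the measurability input for decoupling `A₁`. -/
theorem explored_inter_innerTouching (Z B : Finset V) (A : Finset (Sym2 V)) (C : Set V) :
    explored G Z B (A ∩ innerTouching G Z C) = C ↔ explored G Z B A = C := by
  have key : ∀ u v, u ∈ C → (s(u, v) ∈ (↑((A ∩ innerTouching G Z C) ∩ inner G Z) : Set (Sym2 V)) ↔
      s(u, v) ∈ (↑(A ∩ inner G Z) : Set (Sym2 V))) := by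
    intro u v hu
    simp only [Finset.coe_inter, Set.mem_inter_iff, Finset.mem_coe, innerTouching,
      Finset.mem_filter]
    exact ⟨fun h => ⟨h.1.1, h.2⟩, fun h => ⟨⟨h.1, h.2, u, by simp, hu⟩, h.2⟩⟩
  constructor
  · intro h
    rw [← h]
    exact (cluster_congr fun u v hu => key u v (h.subset hu)).symm
  · intro h
    rw [← h]
    rw [← h] at key
    exact (cluster_congr fun u v hu => (key u v hu).symm).symm

theorem touched_inter_outEdges {Λ Z B : Finset V} {C : Set V} (hC : C ⊆ Z) {A : Finset (Sym2 V)}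
    (hA : A ⊆ touching G Λ) : touched Z B C (A ∩ outEdges G Z C) = touched Z B C A := by
  ext w
  refine and_congr_right fun hw => or_congr_right (
    exists_congr fun u => and_congr_right fun hu => ?_)
  rw [Finset.mem_inter]
  refine ⟨fun h => h.1, fun h => ⟨h, Finset.mem_filter.2 ⟨?_, u, w, rfl, hu, hw⟩⟩⟩
  exact mk_mem_touching.2 ⟨(mk_mem_touching.1 (hA h)).1, Or.inl (hC hu)⟩

/-- Being closed under the `A₁` and `A₂` edges in question, `Y` carries its constant value on the
ball `B` over to everything explored or touched from `B`. -/
theorem Separates.constant {Λ : Finset V} {R : ℕ} {Z : Finset V} {τ : V → ℕ} {W B : Finset V}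
    {A₁ A₂ A₃ : Finset (Sym2 V)} {Y : Set V} (h : Separates G R Z τ W A₁ A₂ A₃ Y)
    (hA : A₂ ⊆ touching G Λ) (hY : ∀ u ∈ B, ∀ v ∈ B, u ∈ Y → v ∈ Y) {x : V} (hx : x ∈ B) :
    (∀ v ∈ explored G Z B A₁, v ∈ Y ↔ x ∈ Y) ∧
      ∀ v ∈ touched Z B (explored G Z B A₁) A₂, v ∈ Y ↔ x ∈ Y := by
  have hB : ∀ v ∈ B, v ∈ Y ↔ x ∈ Y := fun v hv => ⟨hY v hv x hx, hY x hx v hv⟩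
  have hC : ∀ v ∈ explored G Z B A₁, v ∈ Y ↔ x ∈ Y := by
    refine cluster_subset (Y := {v | v ∈ Y ↔ x ∈ Y}) (fun v hv => hB v hv.1) ?_
    intro u v huv (hu : u ∈ Y ↔ x ∈ Y)
    exact (h.closed₁.mem_iff huv).symm.trans hu
  refine ⟨hC, ?_⟩
  rintro v ⟨hv, hvB | ⟨u, hu, huv⟩⟩
  · exact hB v hvB
  · rw [← hC u hu]
    refine (h.closed₂.mem_iff ?_).symm
    rw [Finset.mem_coe, Finset.mem_inter]
    exact ⟨huv, mk_mem_touching.2 ⟨(mk_mem_touching.1 (hA huv)).1,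
      Or.inl (explored_subset Z B A₁ hu)⟩⟩

/-- The integrand on the right bounds the change of `2 ^ O.card`: it is `1/2` if label `0` and
another label are touched, `2` if nothing is touched, and `1` otherwise. The bound `hQ` applies to
the new state because the edges it uses are still unrevealed. -/
theorem exploration_step {Λ : Finset V} {S : Set V} {Z : Finset V} {τ : V → ℕ} {O : Finset ℕ}
    (h : Labelled Λ S Z τ O) {p q r a : ℝ} (hp0 : 0 ≤ p) (hp1 : p ≤ 1) (hq0 : 0 ≤ q) (hq1 : q ≤ 1)
    (hr0 : 0 ≤ r) (hr1 : r ≤ 1) (ha : 0 ≤ a) {R : ℕ} {W B : Finset V} {x : V} (hx : x ∈ B)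
    (hQ : ∀ Z' τ' O', Labelled Λ S Z' τ' O' → sepProb G Λ R p q r Z' τ' W ≤ 2 ^ O'.card * a) :
    (bexp (touching G Λ) p fun A₁ => bexp (touching G Λ) q fun A₂ => bexp (touching G Λ) r
      fun A₃ => ind (∃ Y, Separates G R Z τ W A₁ A₂ A₃ Y ∧ ∀ u ∈ B, ∀ v ∈ B, u ∈ Y → v ∈ Y)) ≤
    2 ^ O.card * a * bexp (touching G Λ) p fun A₁ => bexp (touching G Λ) q fun A₂ =>
      1 - ind ((∃ w ∈ touched Z B (explored G Z B A₁) A₂, τ w = 0) ∧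
        ∃ w ∈ touched Z B (explored G Z B A₁) A₂, τ w ≠ 0) / 2 +
        ind (¬ (touched Z B (explored G Z B A₁) A₂).Nonempty) := by
  set F := touching G Λ with hF
  have hstep := fun (C T : Set V) (hC : C ⊆ Z) (hT : T ⊆ (Z : Set V)ᶜ) =>
    h.exists_step (G := G) hC hT
  choose! τ' O' hstep using hstep
  let T : Set V → Finset (Sym2 V) → Set V := fun C A => touched Z B C A
  have hTZ : ∀ C A, T C A ⊆ (Z : Set V)ᶜ := fun C A w hw => hw.1
  let wt : Set V → Finset (Sym2 V) → ℝ := fun C k =>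
    ind (¬ ((∃ w ∈ T C k, τ w = 0) ∧ ∃ w ∈ T C k, τ w = 1))
  let g : Set V → Finset (Sym2 V) → Finset (Sym2 V) → Finset (Sym2 V) → ℝ := fun C k A₁ A₂ =>
    wt C k * bexp F r fun A₃ =>
      ind (∃ Y, Separates G R (Z.filter (· ∉ C)) (τ' C (T C k)) W A₁ A₂ A₃ Y)
  let H : Set V → Finset (Sym2 V) → ℝ := fun C A₁ =>
    bexp F q fun A₂ => bexp F q fun B₂ => g C (A₂ ∩ outEdges G Z C) A₁ B₂
  have hZF : touching G Z ⊆ F := touching_mono h.sub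
  have s1 : (bexp F p fun A₁ => bexp F q fun A₂ => bexp F r
      fun A₃ => ind (∃ Y, Separates G R Z τ W A₁ A₂ A₃ Y ∧ ∀ u ∈ B, ∀ v ∈ B, u ∈ Y → v ∈ Y)) ≤
      bexp F p fun A₁ => H (explored G Z B A₁) A₁ := by
    refine bexp_mono hp0 hp1 fun A₁ hA₁ => ?_
    set C := explored G Z B A₁ with hCdef
    have hC : C ⊆ Z := explored_subset Z B A₁
    -- The new labels depend on `A₂` only through `outEdges`, the remaining separation event only
    -- through the edges touching `Z \ C`; so `A₂` may be resampled in the latter.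
    have e : H C A₁ = bexp F q fun A₂ => g C (A₂ ∩ outEdges G Z C) A₁ A₂ := by
      refine (bexp_decouple q (fun A₂ => A₂ ∩ outEdges G Z C) (fun _ => outEdges G Z C)
        (fun k A₂ => g C k A₁ A₂) (fun _ => (Finset.filter_subset _ _).trans hZF) ?_ ?_).symm
      · intro A _ k
        rw [Finset.inter_assoc, Finset.inter_self]
      · intro A _ k
        simp only [g]
        congr 1
        refine bexp_congr fun A₃ _ => ind_separates_congr rfl ?_ rfl
        exact sdiff_inter_of_disjoint (disjoint_outEdges Z C)
    rw [e]
    refine bexp_mono hq0 hq1 fun A₂ hA₂ => ?_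
    simp only [g]
    rw [← bexp_mul_left]
    refine bexp_mono hr0 hr1 fun A₃ _ => ?_
    rw [← ind_and]
    refine ind_mono ?_
    rintro ⟨Y, hY, hYB⟩
    obtain ⟨c1, c2⟩ := hY.constant hA₂ hYB hx
    have hTe : T C (A₂ ∩ outEdges G Z C) = touched Z B C A₂ := touched_inter_outEdges hC hA₂
    have hnb : ¬ ((∃ w ∈ T C (A₂ ∩ outEdges G Z C), τ w = 0) ∧
        ∃ w ∈ T C (A₂ ∩ outEdges G Z C), τ w = 1) := by
      rw [hTe]
      rintro ⟨⟨w, hw, hw0⟩, w', hw', hw1⟩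
      exact hY.zero w hw.1 hw0 ((c2 w hw).2 ((c2 w' hw').1 (hY.one w' hw'.1 hw1)))
    refine ⟨hnb, Y, (hstep C _ hC (hTZ _ _)).2.1 hnb R W A₁ A₂ A₃ Y (x ∈ Y) hY c1 ?_⟩
    rw [hTe]; exact c2
  -- The same resampling for `A₁`, once the explored set is known.
  have s2 : (bexp F p fun A₁ => H (explored G Z B A₁) A₁) =
      bexp F p fun A₁ => bexp F p fun B₁ => H (explored G Z B A₁) B₁ := by
    refine bexp_decouple p (fun A₁ => explored G Z B A₁) (fun C => innerTouching G Z C) H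
      (fun C => (Finset.filter_subset _ _).trans ((inner_subset_touching Z).trans hZF))
      (fun A _ C => explored_inter_innerTouching Z B A C) ?_
    intro A _ C
    simp only [H, g]
    refine bexp_congr fun A₂ _ => bexp_congr fun B₂ _ => ?_
    congr 1
    refine bexp_congr fun A₃ _ => ind_separates_congr ?_ rfl rfl
    exact sdiff_inter_of_disjoint (disjoint_innerTouching Z C)
  refine (s1.trans_eq s2).trans ?_
  rw [← bexp_mul_left]
  refine bexp_mono hp0 hp1 fun A₁ hA₁ => ?_
  set C := explored G Z B A₁ with hCdef
  have hC : C ⊆ Z := explored_subset Z B A₁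
  have e3 : (bexp F p fun B₁ => H C B₁) = bexp F q fun A₂ => wt C (A₂ ∩ outEdges G Z C) *
      sepProb G Λ R p q r (Z.filter (· ∉ C)) (τ' C (T C (A₂ ∩ outEdges G Z C))) W := by
    simp only [H]
    rw [bexp_comm]
    refine bexp_congr fun A₂ _ => ?_
    simp only [g, bexp_mul_left]
    rfl
  rw [e3, ← bexp_mul_left]
  refine bexp_mono hq0 hq1 fun A₂ hA₂ => ?_
  obtain ⟨hl, -, hw⟩ := hstep C (T C (A₂ ∩ outEdges G Z C)) hC (hTZ _ _)
  have hTe : T C (A₂ ∩ outEdges G Z C) = touched Z B C A₂ := touched_inter_outEdges hC hA₂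
  have q1 := mul_le_mul_of_nonneg_left (hQ _ _ _ hl)
    (ind_nonneg (¬ ((∃ w ∈ T C (A₂ ∩ outEdges G Z C), τ w = 0) ∧
      ∃ w ∈ T C (A₂ ∩ outEdges G Z C), τ w = 1)))
  refine q1.trans ?_
  rw [← mul_assoc]
  refine (mul_le_mul_of_nonneg_right hw ha).trans (le_of_eq ?_)
  rw [hTe]; ring

end ExplorationStep

/-! ### Exponential decay for deterministic sets that are hard to separate from infinity. -/

section Decay

open Classical

variable {V : Type*} (G : SimpleGraph V) [G.LocallyFinite]

/-- The probability that the exploration from `B` touches a labelled vertex satisfying `P`. -/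
noncomputable def touchProb (Λ : Finset V) (p q : ℝ) (Z B : Finset V) (P : V → Prop) : ℝ :=
  bexp (touching G Λ) p fun A₁ => bexp (touching G Λ) q fun A₂ =>
    ind (∃ w ∈ touched Z B (explored G Z B A₁) A₂, P w)

/-- The probability that the exploration from `B` touches no labelled vertex. -/
noncomputable def untouchedProb (Λ : Finset V) (p q : ℝ) (Z B : Finset V) : ℝ :=
  bexp (touching G Λ) p fun A₁ => bexp (touching G Λ) q fun A₂ =>
    ind (¬ (touched Z B (explored G Z B A₁) A₂).Nonempty)

variable {G}

/-- Harris inequality for two independent layers, by applying the one-layer version twice. -/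
theorem bexp_bexp_mul_le {ι : Type*} [DecidableEq ι] {p q : ℝ} (hp0 : 0 ≤ p) (hp1 : p ≤ 1)
    (hq0 : 0 ≤ q) (hq1 : q ≤ 1) (s : Finset ι) {f g : Finset ι → Finset ι → ℝ}
    (hf : ∀ ⦃A A' B B'⦄, A ⊆ A' → B ⊆ B' → f A B ≤ f A' B')
    (hg : ∀ ⦃A A' B B'⦄, A ⊆ A' → B ⊆ B' → g A B ≤ g A' B') :
    (bexp s p fun A => bexp s q (f A)) * (bexp s p fun A => bexp s q (g A)) ≤
      bexp s p fun A => bexp s q fun B => f A B * g A B := by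
  have hf' : ∀ ⦃A B⦄, A ⊆ B → bexp s q (f A) ≤ bexp s q (f B) := fun A B h =>
    bexp_mono hq0 hq1 fun C _ => hf h (Finset.Subset.refl C)
  have hg' : ∀ ⦃A B⦄, A ⊆ B → bexp s q (g A) ≤ bexp s q (g B) := fun A B h =>
    bexp_mono hq0 hq1 fun C _ => hg h (Finset.Subset.refl C)
  refine (bexp_mul_le hp0 hp1 s hf' hg').trans (bexp_mono hp0 hp1 fun A _ => ?_)
  exact bexp_mul_le hq0 hq1 s (fun _ _ h => hf (Finset.Subset.refl A) h)
    (fun _ _ h => hg (Finset.Subset.refl A) h)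

theorem touched_explored_mono {Z B B' : Finset V} {A₁ A₁' A₂ A₂' : Finset (Sym2 V)}
    (hB : B ⊆ B') (h₁ : A₁ ⊆ A₁') (h₂ : A₂ ⊆ A₂') :
    touched Z B (explored G Z B A₁) A₂ ⊆ touched Z B' (explored G Z B' A₁') A₂' :=
  touched_mono hB (explored_mono hB h₁) h₂

section

variable {Λ Z B B' : Finset V} {p q : ℝ}

theorem touchProb_mono (hp0 : 0 ≤ p) (hp1 : p ≤ 1) (hq0 : 0 ≤ q) (hq1 : q ≤ 1)
    (hB : B ⊆ B') (P : V → Prop) : touchProb G Λ p q Z B P ≤ touchProb G Λ p q Z B' P :=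
  bexp_mono hp0 hp1 fun _ _ => bexp_ind_mono hq0 hq1 fun _ _ ⟨w, hw, h⟩ =>
    ⟨w, touched_explored_mono hB subset_rfl subset_rfl hw, h⟩

theorem untouchedProb_anti (hp0 : 0 ≤ p) (hp1 : p ≤ 1) (hq0 : 0 ≤ q) (hq1 : q ≤ 1)
    (hB : B ⊆ B') : untouchedProb G Λ p q Z B' ≤ untouchedProb G Λ p q Z B :=
  bexp_mono hp0 hp1 fun _ _ => bexp_ind_mono hq0 hq1 fun _ _ h ⟨w, hw⟩ =>
    h ⟨w, touched_explored_mono hB subset_rfl subset_rfl hw⟩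

theorem touchProb_eq_one {P : V → Prop} {v : V} (hv : v ∉ Z) (hvB : v ∈ B) (hP : P v) :
    touchProb G Λ p q Z B P = 1 := by
  unfold touchProb
  rw [bexp_congr (g := fun _ => 1), bexp_const]
  intro A₁ _
  rw [bexp_congr (g := fun _ => 1), bexp_const]
  intro A₂ _
  exact ind_true ⟨v, ⟨hv, Or.inl hvB⟩, hP⟩

theorem one_le_touchProb_add (hp0 : 0 ≤ p) (hp1 : p ≤ 1) (hq0 : 0 ≤ q) (hq1 : q ≤ 1)
    (P : V → Prop) : 1 ≤ touchProb G Λ p q Z B P + touchProb G Λ p q Z B (fun v => ¬ P v) +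
      untouchedProb G Λ p q Z B := by
  unfold touchProb untouchedProb
  rw [← bexp_add, ← bexp_add]
  refine le_bexp hp0 hp1 fun A₁ _ => ?_
  rw [← bexp_add, ← bexp_add]
  refine le_bexp hq0 hq1 fun A₂ _ => ?_
  by_cases h : (touched Z B (explored G Z B A₁) A₂).Nonempty
  · obtain ⟨w, hw⟩ := h
    by_cases hP : P w
    · rw [ind_true (P := ∃ w ∈ touched Z B (explored G Z B A₁) A₂, P w) ⟨w, hw, hP⟩, add_assoc]
      exact le_add_of_nonneg_right (add_nonneg (ind_nonneg _) (ind_nonneg _))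
    · rw [ind_true (P := ∃ w ∈ touched Z B (explored G Z B A₁) A₂, ¬ P w) ⟨w, hw, hP⟩]
      linarith [ind_nonneg (∃ w ∈ touched Z B (explored G Z B A₁) A₂, P w),
        ind_nonneg (¬ (touched Z B (explored G Z B A₁) A₂).Nonempty)]
  · rw [ind_true (P := ¬ (touched Z B (explored G Z B A₁) A₂).Nonempty) h]
    exact le_add_of_nonneg_left (add_nonneg (ind_nonneg _) (ind_nonneg _))

/-- By Harris, both kinds of labels are touched with probability at least `1/8`, so the mean is at
most `1 - 1/16 + 1/32 = 31/32`. -/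
theorem step_weight_le (hp0 : 0 ≤ p) (hp1 : p ≤ 1) (hq0 : 0 ≤ q) (hq1 : q ≤ 1) {P : V → Prop}
    (h₁ : 1 / 4 ≤ touchProb G Λ p q Z B P) (h₂ : 1 / 2 ≤ touchProb G Λ p q Z B fun v => ¬ P v)
    (h₃ : untouchedProb G Λ p q Z B ≤ 1 / 32) :
    (bexp (touching G Λ) p fun A₁ => bexp (touching G Λ) q fun A₂ =>
      1 - ind ((∃ w ∈ touched Z B (explored G Z B A₁) A₂, P w) ∧
        ∃ w ∈ touched Z B (explored G Z B A₁) A₂, ¬ P w) / 2 +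
        ind (¬ (touched Z B (explored G Z B A₁) A₂).Nonempty)) ≤ 31 / 32 := by
  have hm : ∀ P : V → Prop, ∀ ⦃A A' B₁ B₁' : Finset (Sym2 V)⦄, A ⊆ A' → B₁ ⊆ B₁' →
      ind (∃ w ∈ touched Z B (explored G Z B A) B₁, P w) ≤
      ind (∃ w ∈ touched Z B (explored G Z B A') B₁', P w) := fun P _ _ _ _ h h' =>
    ind_mono fun ⟨w, hw, hP⟩ => ⟨w, touched_explored_mono subset_rfl h h' hw, hP⟩
  have harris := bexp_bexp_mul_le hp0 hp1 hq0 hq1 (touching G Λ) (hm P) (hm fun v => ¬ P v)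
  change touchProb G Λ p q Z B P * touchProb G Λ p q Z B (fun v => ¬ P v) ≤ _ at harris
  have h8 : (1 / 4 : ℝ) * (1 / 2) ≤ _ :=
    (mul_le_mul h₁ h₂ (by norm_num) (by linarith)).trans harris
  have e : ∀ A₁, (bexp (touching G Λ) q fun A₂ =>
      1 - ind ((∃ w ∈ touched Z B (explored G Z B A₁) A₂, P w) ∧
        ∃ w ∈ touched Z B (explored G Z B A₁) A₂, ¬ P w) / 2 +
        ind (¬ (touched Z B (explored G Z B A₁) A₂).Nonempty)) =
      1 - (1 / 2) * (bexp (touching G Λ) q fun A₂ =>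
        ind (∃ w ∈ touched Z B (explored G Z B A₁) A₂, P w) *
        ind (∃ w ∈ touched Z B (explored G Z B A₁) A₂, ¬ P w)) +
      bexp (touching G Λ) q fun A₂ =>
        ind (¬ (touched Z B (explored G Z B A₁) A₂).Nonempty) := by
    intro A₁
    rw [bexp_add, bexp_sub, bexp_const, ← bexp_mul_left]
    congr 2
    exact bexp_congr fun A₂ _ => by rw [ind_and]; ring
  simp only [e]
  rw [bexp_add, bexp_sub, bexp_const, bexp_mul_left]
  unfold untouchedProb at h₃
  linarith

/-- If the explored set has at least `j` edges leaving `Z`, all are closed in `A₂` with probability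
at most `(1 - q) ^ j`. Having fewer is unlikely: those edges are independent of the exploration, and
closing them in `A₁` as well, at cost at least `(1 - p) ^ j`, confines the cluster of `B` to `Z`, an
event of probability at most `η`. -/
theorem untouchedProb_le (hZ : Z ⊆ Λ) (hp0 : 0 ≤ p) (hp1 : p < 1) (hq0 : 0 ≤ q) (hq1 : q ≤ 1)
    {η : ℝ} (hη : probInside G p B Z ≤ η) (j : ℕ) :
    untouchedProb G Λ p q Z B ≤ (1 - q) ^ j + η / (1 - p) ^ j := by
  have hpj : 0 < (1 - p) ^ j := pow_pos (by linarith) j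
  have hqj : 0 ≤ (1 - q) ^ j := pow_nonneg (by linarith) j
  have hη0 : 0 ≤ η := (probInside_nonneg hp0 hp1.le _ _).trans hη
  have hZF : touching G Z ⊆ touching G Λ := touching_mono hZ
  have houtF : ∀ C, outEdges G Z C ⊆ touching G Λ :=
    fun C => (Finset.filter_subset _ _).trans hZF
  by_cases hBZ : B ⊆ Z
  swap
  · obtain ⟨v, hvB, hvZ⟩ := Finset.not_subset.1 hBZ
    refine (bexp_le hp0 hp1.le fun A₁ _ => bexp_le hq0 hq1 fun A₂ _ => ?_).trans
      (add_nonneg hqj (div_nonneg hη0 hpj.le))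
    exact (ind_false fun h => h ⟨v, hvZ, Or.inl hvB⟩).le
  have i1 : ∀ A₁ ⊆ touching G Λ, (bexp (touching G Λ) q fun A₂ =>
      ind (¬ (touched Z B (explored G Z B A₁) A₂).Nonempty)) ≤
      (1 - q) ^ j + ((1 - p) ^ j)⁻¹ * (1 - p) ^ (outEdges G Z (explored G Z B A₁)).card := by
    intro A₁ _
    set C := explored G Z B A₁ with hCdef
    have : (bexp (touching G Λ) q fun A₂ => ind (¬ (touched Z B C A₂).Nonempty)) ≤
        (1 - q) ^ (outEdges G Z C).card := by
      rw [← bexp_ind_disjoint (houtF C)]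
      refine bexp_ind_mono hq0 hq1 fun A₂ _ h => ?_
      rw [Finset.disjoint_left]
      intro e he he'
      obtain ⟨-, u, v, rfl, hu, hv⟩ := Finset.mem_filter.1 he'
      exact h ⟨v, hv, Or.inr ⟨u, hu, he⟩⟩
    refine this.trans ?_
    rcases le_or_gt j (outEdges G Z C).card with hj | hj
    · have h1 : (1 - q) ^ (outEdges G Z C).card ≤ (1 - q) ^ j :=
        pow_le_pow_of_le_one (by linarith) (by linarith) hj
      have h2 : 0 ≤ ((1 - p) ^ j)⁻¹ * (1 - p) ^ (outEdges G Z C).card :=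
        mul_nonneg (inv_nonneg.2 hpj.le) (pow_nonneg (by linarith) _)
      linarith
    · have h1 : (1 - q) ^ (outEdges G Z C).card ≤ 1 := pow_le_one₀ (by linarith) (by linarith)
      have h2 : (1 - p) ^ j ≤ (1 - p) ^ (outEdges G Z C).card :=
        pow_le_pow_of_le_one (by linarith) (by linarith) hj.le
      have h3 : 1 ≤ ((1 - p) ^ j)⁻¹ * (1 - p) ^ (outEdges G Z C).card := by
        rw [inv_mul_eq_div, le_div_iff₀ hpj]; linarith
      linarith
  have i2 : (bexp (touching G Λ) p fun A₁ => (1 - p) ^ (outEdges G Z (explored G Z B A₁)).card) ≤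
      η := by
    have hdisj : Disjoint (touching G Λ \ inner G Z) (inner G Z) := Finset.sdiff_disjoint
    have e := bexp_mul_ind_disjoint (s := touching G Λ) (t := touching G Λ \ inner G Z)
      Finset.sdiff_subset p (g := fun _ => 1)
      (D := fun A₁ => outEdges G Z (explored G Z B A₁)) ?_ ?_ (fun _ _ => rfl)
    · simp only [one_mul] at e
      rw [← e]
      refine le_trans ?_ hη
      rw [← probInside_eq hZ]
      refine bexp_ind_mono hp0 hp1.le fun A hA hd => ?_
      refine (cluster_subset (Y := explored G Z B A) ?_ ?_).trans (explored_subset Z B A)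
      · exact fun v hv => subset_cluster _ _ ⟨hv, hBZ hv⟩
      · intro u v huv hu
        have huZ := explored_subset Z B A hu
        have hadj := (mk_mem_touching.1 (hA huv)).1
        by_cases hv : v ∈ Z
        · refine closed_cluster _ _ u v ?_ hu
          rw [Finset.mem_coe, Finset.mem_inter]
          exact ⟨huv, mk_mem_inner.2 ⟨hadj, huZ, hv⟩⟩
        · exact absurd (Finset.mem_filter.2 ⟨mk_mem_touching.2 ⟨hadj, Or.inl huZ⟩, u, v, rfl, hu,
            hv⟩) (Finset.disjoint_left.1 hd huv)
    · intro A _ e he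
      refine Finset.mem_sdiff.2 ⟨houtF _ he, fun h => ?_⟩
      obtain ⟨-, u, v, rfl, hu, hv⟩ := Finset.mem_filter.1 he
      exact hv (mk_mem_inner.1 h).2.2
    · intro A _
      simp only [explored]
      rw [sdiff_inter_of_disjoint hdisj]
  calc untouchedProb G Λ p q Z B ≤ _ := bexp_mono hp0 hp1.le i1
    _ = (1 - q) ^ j + ((1 - p) ^ j)⁻¹ * _ := by rw [bexp_add, bexp_const, bexp_mul_left]
    _ ≤ (1 - q) ^ j + ((1 - p) ^ j)⁻¹ * η := by
        have := mul_le_mul_of_nonneg_left i2 (inv_nonneg.2 hpj.le); linarith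
    _ = _ := by rw [inv_mul_eq_div]

end

/-- A finite set containing `S` has many boundary edges, and hence one with its inner endpoint
outside of a given small set. -/
theorem exists_boundary_edge {S : Set V} {n : ℕ} (h : (n : ℕ∞) ≤ cutsetSize G S) {T U : Finset V}
    (hST : S ⊆ T) {d : ℕ} (hd : ∀ v, G.degree v ≤ d) (hU : U.card * d < n) :
    ∃ x ∈ T, x ∉ U ∧ ∃ y, y ∉ T ∧ G.Adj x y := by
  by_contra! hcon
  have h1 : (n : ℕ∞) ≤ (edgeBoundary G T).encard :=
    h.trans (iInf₂_le_of_le (T : Set V) hST (iInf_le _ T.finite_toSet))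
  have h2 : edgeBoundary G T ⊆ touching G U := by
    rintro e ⟨he, u, v, rfl, hu, hv⟩
    refine mk_mem_touching.2 ⟨he, Or.inl ?_⟩
    by_contra huU
    exact hcon u hu huU v hv he
  have h3 : (touching G U).card ≤ U.card * d :=
    Finset.card_biUnion_le_card_mul _ _ _ fun v _ => by
      rw [SimpleGraph.card_incidenceFinset_eq_degree]; exact hd v
  have h4 := h1.trans ((Set.encard_le_encard h2).trans_eq (Set.encard_coe_eq_coe_finsetCard _))
  have h5 : n ≤ (touching G U).card := by exact_mod_cast h4
  omega

theorem Separates.insert {R : ℕ} {Z : Finset V} {τ : V → ℕ} {W : Finset V}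
    {A₁ A₂ A₃ : Finset (Sym2 V)} {Y : Set V} (h : Separates G R Z τ W A₁ A₂ A₃ Y) (x : V) :
    Separates G R Z τ (insert x W) A₁ A₂ A₃ Y :=
  ⟨h.one, h.zero, h.label, h.closed₁, h.closed₂, h.closed₃.mono (by
    exact_mod_cast Finset.sdiff_subset_sdiff subset_rfl
      (Finset.biUnion_subset_biUnion_of_subset_left _ (Finset.subset_insert x W)))⟩

/-- If all edges inside a ball are open, it is contained in a single cluster. -/
theorem Separates.constant_of_subset {Λ : Finset V} {S : Set V} {O : Finset ℕ} {R : ℕ}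
    {Z : Finset V} {τ : V → ℕ} {W : Finset V} {A₁ A₂ A₃ : Finset (Sym2 V)} {Y : Set V} {x : V}
    (h : Separates G R Z τ W A₁ A₂ A₃ Y) (hl : Labelled Λ S Z τ O)
    (hx : ∀ w ∈ W, x ∉ ball G w (R + R)) (hA : inner G (ball G x R) ∩ touching G Λ ⊆ A₃) :
    ∀ u ∈ ball G x R, ∀ v ∈ ball G x R, u ∈ Y → v ∈ Y := by
  intro u hu v hv huY
  refine ball_subset_of_closed hu huY ?_ hv
  intro u hu v hv huv huY
  by_cases hΛ : u ∈ Λ ∨ v ∈ Λ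
  · refine h.closed₃ u v ?_ huY
    rw [Finset.mem_coe, Finset.mem_sdiff]
    refine ⟨hA (Finset.mem_inter.2 ⟨mk_mem_inner.2 ⟨huv, hu, hv⟩, mk_mem_touching.2 ⟨huv, hΛ⟩⟩),
      fun hW => ?_⟩
    obtain ⟨w, hw, hin⟩ := Finset.mem_biUnion.1 hW
    exact hx w hw (ball_trans (mk_mem_inner.1 hin).2.1 (ball_symm hu))
  -- Edges with both ends outside `Λ` are not sampled, but there every vertex has label `0` and is
  -- not in `Y`.
  · push Not at hΛ
    exact absurd huY (h.zero u (fun hZ => hΛ.1 (hl.sub hZ)) (hl.out u hΛ.1))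

/-- Condition on whether the ball around `x` is fully open in `A₃`. Its edges are unused so far, as
`x` is far from `W`, and after `x` joins `W` they are never used again. An open ball forces `Y` to
be constant on it. -/
theorem sepProb_split {Λ : Finset V} {S : Set V} {O : Finset ℕ} {R : ℕ} {p q r : ℝ}
    (hp0 : 0 ≤ p) (hp1 : p ≤ 1) (hq0 : 0 ≤ q) (hq1 : q ≤ 1) (hr0 : 0 ≤ r) (hr1 : r ≤ 1)
    {Z : Finset V} {τ : V → ℕ} {W : Finset V} (hl : Labelled Λ S Z τ O) {x : V}
    (hx : ∀ w ∈ W, x ∉ ball G w (R + R)) {a b : ℝ}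
    (ha : (bexp (touching G Λ) p fun A₁ => bexp (touching G Λ) q fun A₂ =>
      bexp (touching G Λ) r fun A₃ => ind (∃ Y, Separates G R Z τ (insert x W) A₁ A₂ A₃ Y ∧
        ∀ u ∈ ball G x R, ∀ v ∈ ball G x R, u ∈ Y → v ∈ Y)) ≤ a)
    (hb : sepProb G Λ R p q r Z τ (insert x W) ≤ b) (hab : a ≤ b) {M : ℕ}
    (hM : (inner G (ball G x R)).card ≤ M) :
    sepProb G Λ R p q r Z τ W ≤ r ^ M * a + (1 - r ^ M) * b := by
  set E := inner G (ball G x R) ∩ touching G Λ with hE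
  have hEF : E ⊆ touching G Λ := Finset.inter_subset_right
  have hdep' : ∀ A₃ ⊆ touching G Λ, (A₃ \ E) \ ballEdges G R (insert x W) =
      A₃ \ ballEdges G R (insert x W) := by
    intro A₃ _
    ext e
    simp only [Finset.mem_sdiff, Finset.mem_inter, hE, ballEdges, Finset.mem_biUnion,
      Finset.mem_insert]
    constructor
    · exact fun h => ⟨h.1.1, h.2⟩
    · exact fun h => ⟨⟨h.1, fun h' => h.2 ⟨x, Or.inl rfl, h'.1⟩⟩, h.2⟩
  let f : Finset (Sym2 V) → Finset (Sym2 V) → Finset (Sym2 V) → ℝ := fun A₁ A₂ A₃ =>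
    ind (∃ Y, Separates G R Z τ (insert x W) A₁ A₂ A₃ Y ∧
        ∀ u ∈ ball G x R, ∀ v ∈ ball G x R, u ∈ Y → v ∈ Y)
  let g : Finset (Sym2 V) → Finset (Sym2 V) → Finset (Sym2 V) → ℝ := fun A₁ A₂ A₃ =>
    ind (∃ Y, Separates G R Z τ (insert x W) A₁ A₂ A₃ Y)
  have hin : ∀ A₁ A₂, (bexp (touching G Λ) r fun A₃ => ind (∃ Y, Separates G R Z τ W A₁ A₂ A₃ Y)) ≤
      r ^ E.card * bexp (touching G Λ) r (f A₁ A₂) +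
        (1 - r ^ E.card) * bexp (touching G Λ) r (g A₁ A₂) := by
    intro A₁ A₂
    have i1 : ∀ A ⊆ touching G Λ, ind (E ⊆ A ∩ E) = ind (E ⊆ A) := fun A _ =>
      ind_congr (by simp [Finset.subset_inter_iff])
    have e1 : (bexp (touching G Λ) r fun A₃ => ind (E ⊆ A₃) * f A₁ A₂ A₃) =
        r ^ E.card * bexp (touching G Λ) r (f A₁ A₂) := by
      rw [← bexp_ind_subset hEF r]
      refine bexp_mul_of_disjoint hEF r i1 fun A₃ hA₃ => ind_congr ?_
      exact exists_congr fun Y => and_congr_left fun _ =>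
        ⟨fun h => h.congr rfl rfl (hdep' A₃ hA₃), fun h => h.congr rfl rfl (hdep' A₃ hA₃).symm⟩
    have e2 : (bexp (touching G Λ) r fun A₃ => ind (E ⊆ A₃) * g A₁ A₂ A₃) =
        r ^ E.card * bexp (touching G Λ) r (g A₁ A₂) := by
      rw [← bexp_ind_subset hEF r]
      exact bexp_mul_of_disjoint hEF r i1 fun A₃ hA₃ =>
        ind_separates_congr rfl rfl (hdep' A₃ hA₃)
    have : (bexp (touching G Λ) r fun A₃ => ind (∃ Y, Separates G R Z τ W A₁ A₂ A₃ Y)) ≤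
        bexp (touching G Λ) r fun A₃ => ind (E ⊆ A₃) * f A₁ A₂ A₃ +
          (g A₁ A₂ A₃ - ind (E ⊆ A₃) * g A₁ A₂ A₃) := by
      refine bexp_mono hr0 hr1 fun A₃ _ => ?_
      have hg : ind (∃ Y, Separates G R Z τ W A₁ A₂ A₃ Y) ≤ g A₁ A₂ A₃ :=
        ind_mono fun ⟨Y, hY⟩ => ⟨Y, hY.insert x⟩
      by_cases hEA : E ⊆ A₃
      · have hf : ind (∃ Y, Separates G R Z τ W A₁ A₂ A₃ Y) ≤ f A₁ A₂ A₃ :=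
          ind_mono fun ⟨Y, hY⟩ => ⟨Y, hY.insert x, hY.constant_of_subset hl hx hEA⟩
        rw [ind_true hEA]; linarith
      · rw [ind_false hEA]; linarith
    rw [bexp_add, bexp_sub, e1, e2] at this
    linarith
  have hout : sepProb G Λ R p q r Z τ W ≤ r ^ E.card *
      (bexp (touching G Λ) p fun A₁ => bexp (touching G Λ) q fun A₂ =>
        bexp (touching G Λ) r (f A₁ A₂)) +
      (1 - r ^ E.card) * sepProb G Λ R p q r Z τ (insert x W) := by
    have := bexp_mono (s := touching G Λ) hp0 hp1 fun A₁ _ =>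
      bexp_mono (s := touching G Λ) hq0 hq1 fun A₂ _ => hin A₁ A₂
    simp only [bexp_add, bexp_mul_left] at this
    exact this
  have hE1 : r ^ E.card ≤ 1 := pow_le_one₀ hr0 hr1
  have hEM : r ^ M ≤ r ^ E.card :=
    pow_le_pow_of_le_one hr0 hr1 ((Finset.card_le_card Finset.inter_subset_left).trans hM)
  have hE0 : 0 ≤ r ^ E.card := pow_nonneg hr0 _
  have h1 := mul_le_mul_of_nonneg_left ha hE0
  have h2 := mul_le_mul_of_nonneg_left hb (sub_nonneg.2 hE1)
  -- As `a ≤ b`, the convex combination only grows when the weight of `a` is lowered from `r ^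
  -- E.card` to `r ^ M`.
  have h3 := mul_le_mul_of_nonneg_right hEM (sub_nonneg.2 hab)
  linarith

/-- The main induction: each step either reduces the number of labels, or uses up one ball. -/
theorem sepProb_le {Λ : Finset V} {S : Set V} {n : ℕ} (hn : (n : ℕ∞) ≤ cutsetSize G S) {m : ℕ}
    {p q r : ℝ} (hp0 : 0 ≤ p) (hp1 : p ≤ 1) (hq0 : 0 ≤ q) (hq1 : q ≤ 1) (hr0 : 0 ≤ r) (hr1 : r ≤ 1)
    (hm : ∀ z, ∀ Z ⊆ Λ, untouchedProb G Λ p q Z (ball G z m) ≤ 1 / 32)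
    {d N M : ℕ} (hd : ∀ v, G.degree v ≤ d) (hN : ∀ v, (ball G v (m + 1 + (m + 1))).card ≤ N)
    (hM : ∀ v, (inner G (ball G v (m + 1))).card ≤ M) (s : ℕ) :
    ∀ (Z : Finset V) (τ : V → ℕ) (O : Finset ℕ) (W : Finset V), Labelled Λ S Z τ O →
      (N * d + 1) * (W.card + s) ≤ n →
      sepProb G Λ (m + 1) p q r Z τ W ≤ 2 ^ O.card * (1 - r ^ M / 32) ^ s := by
  have hρ : 0 ≤ 1 - r ^ M / 32 := by
    have : r ^ M ≤ 1 := pow_le_one₀ hr0 hr1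
    linarith
  induction s with
  | zero =>
    intro Z τ O W _ _
    have h1 : sepProb G Λ (m + 1) p q r Z τ W ≤ 1 :=
      bexp_le hp0 hp1 fun _ _ => bexp_le hq0 hq1 fun _ _ => bexp_le hr0 hr1 fun _ _ => ind_le_one _
    have h2 : (1 : ℝ) ≤ 2 ^ O.card := one_le_pow₀ (by norm_num)
    simpa using h1.trans h2
  | succ s ih =>
    intro Z τ O W hl hs
    -- `T` lies in `Λ` and contains `S`, so it has at least `n` boundary edges. Across one of them
    -- the likely touched label changes from nonzero to `0`; radius `m + 1` around `x` covers the
    -- `m`-balls of both endpoints.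
    set T : Finset V := Λ.filter fun v => ¬ (v ∉ Z ∧ τ v = 0) ∧
      1 / 2 ≤ touchProb G Λ p q Z (ball G v m) (fun w => ¬ τ w = 0) with hT
    have hST : S ⊆ T := by
      intro v hv
      obtain ⟨hvZ, hv1⟩ := hl.src v hv
      have hv0 : ¬ τ v = 0 := by omega
      refine Finset.mem_filter.2 ⟨?_, fun h => hv0 h.2, ?_⟩
      · by_contra hvΛ; exact hv0 (hl.out v hvΛ)
      · rw [touchProb_eq_one hvZ (self_mem_ball v m) hv0]; norm_num
    have hU : (W.biUnion fun w => ball G w (m + 1 + (m + 1))).card * d < n := by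
      have h1 : (W.biUnion fun w => ball G w (m + 1 + (m + 1))).card ≤ W.card * N :=
        Finset.card_biUnion_le_card_mul _ _ _ fun v _ => hN v
      have h2 := Nat.mul_le_mul_right d h1
      have e : (N * d + 1) * (W.card + (s + 1)) =
          W.card * N * d + (N * d * (s + 1) + W.card + s) + 1 := by ring
      linarith [Nat.zero_le (N * d * (s + 1) + W.card + s)]
    obtain ⟨x, hxT, hxU, y, hyT, hxy⟩ := exists_boundary_edge hn hST hd hU
    have hxW : ∀ w ∈ W, x ∉ ball G w (m + 1 + (m + 1)) := fun w hw h =>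
      hxU (Finset.mem_biUnion.2 ⟨w, hw, h⟩)
    have hBx : ball G x m ⊆ ball G x (m + 1) := ball_subset_succ x m
    have hBy : ball G y m ⊆ ball G x (m + 1) := fun v hv => by
      rw [Nat.add_comm]; exact ball_trans (mem_ball_one_of_adj hxy) hv
    have hO := (hT ▸ hxT : x ∈ Finset.filter _ _)
    rw [Finset.mem_filter] at hO
    have t1 : 1 / 2 ≤ touchProb G Λ p q Z (ball G x (m + 1)) (fun w => ¬ τ w = 0) :=
      hO.2.2.trans (touchProb_mono hp0 hp1 hq0 hq1 hBx _)
    have t2 : untouchedProb G Λ p q Z (ball G x (m + 1)) ≤ 1 / 32 :=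
      (untouchedProb_anti hp0 hp1 hq0 hq1 hBx).trans (hm x Z hl.sub)
    -- Either `y` has label `0` itself, or its ball touches label `0` with probability at least `1 -
    -- 1/2 - 1/32`.
    have t0 : 1 / 4 ≤ touchProb G Λ p q Z (ball G x (m + 1)) (fun w => τ w = 0) := by
      by_cases hy0 : y ∉ Z ∧ τ y = 0
      · rw [touchProb_eq_one hy0.1 (hBy (self_mem_ball y m)) hy0.2]; norm_num
      · have hyΛ : y ∈ Λ := by
          by_contra hyΛ; exact hy0 ⟨fun h => hyΛ (hl.sub h), hl.out y hyΛ⟩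
        have h1 : touchProb G Λ p q Z (ball G y m) (fun w => ¬ τ w = 0) < 1 / 2 := by
          by_contra! h1; exact hyT (Finset.mem_filter.2 ⟨hyΛ, hy0, h1⟩)
        have h2 := one_le_touchProb_add (G := G) (Λ := Λ) (Z := Z) (B := ball G y m)
          hp0 hp1 hq0 hq1 (fun w => τ w = 0)
        have h3 := hm y Z hl.sub
        have h4 := touchProb_mono (G := G) (Λ := Λ) (Z := Z) hp0 hp1 hq0 hq1 hBy
          (fun w => τ w = 0)
        linarith
    have hW : (N * d + 1) * ((insert x W).card + s) ≤ n := by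
      refine le_trans (Nat.mul_le_mul_left _ ?_) hs
      have := Finset.card_insert_le x W
      omega
    have hpow : 0 ≤ (1 - r ^ M / 32) ^ s := pow_nonneg hρ s
    have step := exploration_step hl hp0 hp1 hq0 hq1 hr0 hr1 hpow
      (self_mem_ball (G := G) x (m + 1)) (fun Z' τ' O' hl' => ih Z' τ' O' (insert x W) hl' hW)
    have hbpos : (0 : ℝ) ≤ 2 ^ O.card * (1 - r ^ M / 32) ^ s := by positivity
    have step' := step.trans
      (mul_le_mul_of_nonneg_left (step_weight_le hp0 hp1 hq0 hq1 t0 t1 t2) hbpos)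
    have := sepProb_split hp0 hp1 hq0 hq1 hr0 hr1 hl hxW step' (ih Z τ O (insert x W) hl hW)
      (by linarith) (hM x)
    refine this.trans (le_of_eq ?_)
    rw [pow_succ]; ring

/-- Initial state of the exploration: `S` has label `1`, the outside of `Λ` label `0`, and the
cluster of `S` in the union of the three layers is the separating set. -/
theorem probInside_le_sepProb {Λ : Finset V} {S : Set V} (hS : S ⊆ Λ) {p q r : ℝ}
    (hp0 : 0 ≤ p) (hp1 : p ≤ 1) (hq0 : 0 ≤ q) (hq1 : q ≤ 1) (hr0 : 0 ≤ r) (hr1 : r ≤ 1) (R : ℕ) :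
    probInside G (p + (q + r - q * r) - p * (q + r - q * r)) S Λ ≤
      sepProb G Λ R p q r (Λ.filter (· ∉ S)) (fun v => if v ∈ S then 1 else 0) ∅ := by
  have hlab : ∀ v, v ∉ Λ.filter (· ∉ S) → v ∈ S ∨ v ∉ Λ := fun v hv => by
    by_contra! h; exact hv (Finset.mem_filter.2 ⟨h.2, h.1⟩)
  unfold probInside sepProb
  rw [← bexp_bexp_union]
  refine bexp_mono hp0 hp1 fun A₁ _ => ?_
  rw [← bexp_bexp_union]
  refine bexp_mono hq0 hq1 fun A₂ _ => bexp_ind_mono hr0 hr1 fun A₃ _ h => ?_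
  set Y := cluster (↑(A₁ ∪ (A₂ ∪ A₃)) : Set (Sym2 V)) S with hY
  have hSY : S ⊆ Y := subset_cluster _ _
  have hcl : Closed (↑(A₁ ∪ (A₂ ∪ A₃)) : Set (Sym2 V)) Y := closed_cluster _ _
  refine ⟨Y, fun v _ h1 => ?_, fun v hv h0 hvY => ?_, fun u hu v hv huv huY => ?_, hcl.mono ?_,
    hcl.mono ?_, hcl.mono ?_⟩
  · by_cases hvS : v ∈ S
    · exact hSY hvS
    · simp [hvS] at h1
  · rcases hlab v hv with hvS | hvΛ
    · simp [hvS] at h0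
    · exact hvΛ (h hvY)
  · rcases hlab v hv with hvS | hvΛ
    · exact hSY hvS
    · have hvS : v ∉ S := fun h => hvΛ (hS h)
      have huS : u ∉ S := fun huS => by simp [huS, hvS] at huv
      rcases hlab u hu with huS' | huΛ
      · exact absurd huS' huS
      · exact absurd (h huY) huΛ
  · intro e he
    simp only [Finset.coe_inter, Finset.coe_union, Set.mem_inter_iff, Set.mem_union] at he ⊢
    tauto
  · intro e he
    simp only [Finset.coe_inter, Finset.coe_union, Set.mem_inter_iff, Set.mem_union] at he ⊢
    tauto
  · intro e he
    simp only [Finset.coe_sdiff, Finset.coe_union, Set.mem_sdiff, Set.mem_union] at he ⊢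
    tauto

/-- A set that is hard to separate from infinity is unlikely to be disconnected from infinity. -/
theorem exists_probInside_le_pow [Infinite V] (hc : G.Connected) (hG : IsTransitive G)
    {p₀ p₁ θ : ℝ} (h0 : 0 ≤ p₀) (h01 : p₀ < p₁) (h1 : p₁ < 1) (hθ : 0 < θ) {o : V}
    (h : ∀ Λ, probInside G p₀ {o} Λ ≤ 1 - θ) :
    ∃ (ρ : ℝ) (κ : ℕ), 0 < ρ ∧ ρ < 1 ∧ 0 < κ ∧ ∀ (S : Set V) (Λ : Finset V) (n : ℕ),
      (n : ℕ∞) ≤ cutsetSize G S → probInside G p₁ S Λ ≤ ρ ^ (n / κ) := by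
  have hp1 : p₀ < 1 := h01.trans h1
  -- With `1 - p₁ = (1 - p₀) * t * t`, level `p₁` is the union of level `p₀` and two layers at level
  -- `1 - t`.
  set t := Real.sqrt ((1 - p₁) / (1 - p₀)) with ht
  have hpos : 0 < (1 - p₁) / (1 - p₀) := div_pos (by linarith) (by linarith)
  have ht0 : 0 < t := Real.sqrt_pos.2 hpos
  have htt : t * t = (1 - p₁) / (1 - p₀) := Real.mul_self_sqrt hpos.le
  have ht1 : t < 1 := by
    rw [ht, Real.sqrt_lt' one_pos, one_pow, div_lt_one (by linarith)]; linarith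
  have hlevel : p₁ = p₀ + ((1 - t) + (1 - t) - (1 - t) * (1 - t)) -
      p₀ * ((1 - t) + (1 - t) - (1 - t) * (1 - t)) := by
    have : (1 - p₀) * (t * t) = 1 - p₁ := by rw [htt]; field_simp [(by linarith : 1 - p₀ ≠ 0)]
    linarith
  -- The two terms of `untouchedProb_le` are each made at most `1/64`: first `j` is chosen, then the
  -- radius `m`.
  obtain ⟨j, hj⟩ := exists_pow_lt_of_lt_one (by norm_num : (0 : ℝ) < 1 / 64) ht1
  have hpj : 0 < (1 - p₀) ^ j := pow_pos (by linarith) j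
  obtain ⟨m, hm⟩ := exists_ball_probInside_le hc hG h0 hp1.le hθ h
    (by positivity : 0 < (1 - p₀) ^ j / 64)
  have hr0 : 0 < 1 - t := by linarith
  have hr1 : 1 - t ≤ 1 := by linarith
  have hunt : ∀ Λ : Finset V, ∀ z, ∀ Z ⊆ Λ,
      untouchedProb G Λ p₀ (1 - t) Z (ball G z m) ≤ 1 / 32 := by
    intro Λ z Z hZ
    have := untouchedProb_le hZ h0 hp1 hr0.le hr1 (hm z Z) j
    rw [div_right_comm, div_self hpj.ne', sub_sub_cancel] at this
    linarith
  set N := (ball G o (m + 1 + (m + 1))).card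
  set d := G.degree o
  have hM : ∀ v, (inner G (ball G v (m + 1))).card ≤ (ball G o (m + 1)).card * d := fun v => by
    rw [card_ball hG o v]
    refine (Finset.card_le_card (inner_subset_touching _)).trans ?_
    exact Finset.card_biUnion_le_card_mul _ _ _ fun v _ => by
      rw [SimpleGraph.card_incidenceFinset_eq_degree, degree_eq hG v o]
  set M := (ball G o (m + 1)).card * d
  have hrM : (1 - t) ^ M ≤ 1 := pow_le_one₀ hr0.le hr1
  have hrM0 : 0 < (1 - t) ^ M := pow_pos hr0 M
  refine ⟨1 - (1 - t) ^ M / 32, N * d + 1, by linarith, by linarith, by omega,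
    fun S Λ n hn => ?_⟩
  by_cases hS : S ⊆ Λ
  · have key := probInside_le_sepProb (G := G) hS h0 hp1.le hr0.le hr1 hr0.le hr1 (m + 1)
    rw [← hlevel] at key
    have hl : Labelled Λ S (Λ.filter (· ∉ S)) (fun v => if v ∈ S then 1 else 0) ∅ := by
      refine ⟨Finset.filter_subset _ _, fun v _ => ?_, by simp, by simp, fun v hv => ?_,
        fun v hv => ?_⟩
      · by_cases hv : v ∈ S <;> simp [hv]
      · exact if_neg fun h => hv (hS h)
      · exact ⟨fun h => (Finset.mem_filter.1 h).2 hv, if_pos hv⟩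
    have := sepProb_le hn h0 hp1.le hr0.le hr1 hr0.le hr1 (hunt Λ) (fun v => (degree_eq hG v o).le)
      (fun v => (card_ball hG v o _).le) hM (n / (N * d + 1)) _ _ _ ∅ hl
      (by rw [Finset.card_empty, zero_add]; exact Nat.mul_div_le n _)
    rw [Finset.card_empty, pow_zero, one_mul] at this
    exact key.trans this
  · have : probInside G p₁ S Λ ≤ 0 := bexp_le (by linarith) h1.le fun A _ =>
      (ind_false fun h => hS ((subset_cluster _ _).trans h)).le
    exact this.trans (pow_nonneg (by linarith) _)

end Decay

/-! ### From deterministic sets to the random cluster, by sprinkling. -/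

section FiniteVolume

open Classical

variable {V : Type*} {G : SimpleGraph V} [G.LocallyFinite]

theorem cluster_cluster_subset {A B : Set (Sym2 V)} {S : Set V} {v : V} (hAB : A ⊆ B)
    (hv : v ∈ cluster B S) : cluster A {v} ⊆ cluster B S :=
  cluster_subset (Set.singleton_subset_iff.2 hv) ((closed_cluster B S).mono hAB)

variable (G) in
/-- The edges touching both `Λ` and `C`. -/
noncomputable def touchingSet (Λ : Finset V) (C : Set V) : Finset (Sym2 V) :=
  (touching G Λ).filter fun e => ∃ v ∈ e, v ∈ C

variable (G) in
/-- The boundary edges of `C` whose outer endpoint is connected to the complement of `Λ` by edges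
of `A` not touching `C`. -/
noncomputable def pivotalEdges (Λ : Finset V) (C : Set V) (A : Finset (Sym2 V)) :
    Finset (Sym2 V) :=
  (touching G Λ).filter fun e => ∃ u v, e = s(u, v) ∧ u ∈ C ∧ v ∉ C ∧
    ¬ cluster (↑(A \ touchingSet G Λ C) : Set (Sym2 V)) {v} ⊆ Λ

theorem pivotalEdges_subset (Λ : Finset V) (C : Set V) (A : Finset (Sym2 V)) :
    pivotalEdges G Λ C A ⊆ touchingSet G Λ C := by
  intro e he
  obtain ⟨heF, u, v, rfl, hu, -, -⟩ := Finset.mem_filter.1 he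
  exact Finset.mem_filter.2 ⟨heF, u, by simp, hu⟩

theorem pivotalEdges_sdiff (Λ : Finset V) (C : Set V) (A : Finset (Sym2 V)) :
    pivotalEdges G Λ C (A \ touchingSet G Λ C) = pivotalEdges G Λ C A := by
  unfold pivotalEdges
  rw [sdiff_idem]

theorem cluster_subset_of_disjoint_pivotalEdges {Λ : Finset V} {C : Set V} (hC : C ⊆ Λ)
    {A : Finset (Sym2 V)} (hA : A ⊆ touching G Λ) (h : Disjoint A (pivotalEdges G Λ C A)) :
    cluster (A : Set (Sym2 V)) C ⊆ Λ := by
  set A' := A \ touchingSet G Λ C with hA'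
  refine (cluster_subset (Y := C ∪ {v | v ∉ C ∧ cluster (A' : Set (Sym2 V)) {v} ⊆ Λ})
    Set.subset_union_left ?_).trans (Set.union_subset hC fun v hv =>
      hv.2 (subset_cluster _ _ rfl))
  intro u v huv hu
  by_cases hv : v ∈ C
  · exact Or.inl hv
  refine Or.inr ⟨hv, ?_⟩
  rcases hu with hu | ⟨hu, huΛ⟩
  · by_contra hcon
    exact Finset.disjoint_left.1 h huv (Finset.mem_filter.2 ⟨hA huv, u, v, rfl, hu, hv, hcon⟩)
  · refine (cluster_cluster_subset subset_rfl ?_).trans huΛ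
    refine closed_cluster _ _ u v ?_ (subset_cluster _ _ rfl)
    refine Finset.mem_coe.2 (Finset.mem_sdiff.2 ⟨huv, fun h' => ?_⟩)
    obtain ⟨-, w, hw, hwC⟩ := Finset.mem_filter.1 h'
    rcases Sym2.mem_iff.1 hw with rfl | rfl
    · exact hu hwC
    · exact hv hwC

/-- Given the edges not touching `C`, fewer than `k` pivotal edges are all closed with probability
at least `(1 - p) ^ k`, and then `C` is confined to `Λ`. -/
theorem bexp_card_pivotalEdges_lt_le {p : ℝ} (hp0 : 0 ≤ p) (hp1 : p < 1) {Λ : Finset V}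
    {C : Set V} (hC : C ⊆ Λ) (k : ℕ) :
    (bexp (touching G Λ) p fun A => ind ((pivotalEdges G Λ C A).card < k)) ≤
      probInside G p C Λ / (1 - p) ^ k := by
  have hpk : 0 < (1 - p) ^ k := pow_pos (by linarith) k
  rw [le_div_iff₀ hpk, mul_comm, ← bexp_mul_left]
  have e := bexp_mul_ind_disjoint (s := touching G Λ) (t := touchingSet G Λ C)
    (Finset.filter_subset _ _) p (g := fun _ => 1) (D := fun A => pivotalEdges G Λ C A)
    (fun A _ => pivotalEdges_subset Λ C A) (fun A _ => pivotalEdges_sdiff Λ C A) (fun _ _ => rfl)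
  simp only [one_mul] at e
  have h2 : (bexp (touching G Λ) p fun A => ind (Disjoint A (pivotalEdges G Λ C A))) ≤
      probInside G p C Λ := bexp_ind_mono hp0 hp1.le fun A hA h =>
    cluster_subset_of_disjoint_pivotalEdges hC hA h
  refine le_trans ?_ (e ▸ h2)
  refine bexp_mono hp0 hp1.le fun A _ => ?_
  by_cases h : (pivotalEdges G Λ C A).card < k
  · rw [ind_true h, mul_one]
    exact pow_le_pow_of_le_one (by linarith) (by linarith) h.le
  · rw [ind_false h, mul_zero]
    exact pow_nonneg (by linarith) _

/-- With `A₂` fixed, the cluster is determined by the edges of `A₁` touching it and the pivotal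
edges by the others, so the random cluster may be treated as a deterministic set `C`. -/
theorem bexp_cluster_pivotal_lt_le {p b : ℝ} (hp0 : 0 ≤ p) (hp1 : p < 1) (hb : 0 ≤ b)
    {Λ : Finset V} {n : ℕ}
    (h : ∀ C : Set V, (n : ℕ∞) ≤ cutsetSize G C → probInside G p C Λ ≤ b) (S : Set V)
    {A₂ : Finset (Sym2 V)} (k : ℕ) :
    (bexp (touching G Λ) p fun A₁ =>
      ind ((cluster (↑(A₁ ∪ A₂) : Set (Sym2 V)) S ⊆ Λ ∧
        (n : ℕ∞) ≤ cutsetSize G (cluster (↑(A₁ ∪ A₂) : Set (Sym2 V)) S)) ∧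
        (pivotalEdges G Λ (cluster (↑(A₁ ∪ A₂) : Set (Sym2 V)) S) A₁).card < k)) ≤
      b / (1 - p) ^ k := by
  have hpk : 0 < (1 - p) ^ k := pow_pos (by linarith) k
  have e := bexp_decouple (s := touching G Λ) p
    (fun A₁ => cluster (↑(A₁ ∪ A₂) : Set (Sym2 V)) S) (fun C => touchingSet G Λ C)
    (fun C A₁ => ind ((C ⊆ Λ ∧ (n : ℕ∞) ≤ cutsetSize G C) ∧
      (pivotalEdges G Λ C A₁).card < k)) (fun C => Finset.filter_subset _ _) ?_ ?_
  · rw [e]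
    refine bexp_le hp0 hp1.le fun A₁ _ => ?_
    generalize cluster (↑(A₁ ∪ A₂) : Set (Sym2 V)) S = C
    simp only [ind_and (C ⊆ Λ ∧ (n : ℕ∞) ≤ cutsetSize G C)]
    rw [bexp_mul_left]
    by_cases hC : C ⊆ Λ ∧ (n : ℕ∞) ≤ cutsetSize G C
    · rw [ind_true hC, one_mul]
      exact (bexp_card_pivotalEdges_lt_le hp0 hp1 hC.1 k).trans
        (div_le_div_of_nonneg_right (h C hC.2) hpk.le)
    · rw [ind_false hC, zero_mul]
      exact div_nonneg hb hpk.le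
  · intro A hA C
    have key : ∀ u v, u ∈ C → (s(u, v) ∈ (↑((A ∩ touchingSet G Λ C) ∪ A₂) : Set (Sym2 V)) ↔
        s(u, v) ∈ (↑(A ∪ A₂) : Set (Sym2 V))) := by
      intro u v hu
      simp only [Finset.mem_coe, Finset.mem_union, Finset.mem_inter, touchingSet,
        Finset.mem_filter]
      refine or_congr_left ⟨fun h => h.1, fun h => ⟨h, hA h, u, by simp, hu⟩⟩
    constructor
    · intro hc
      rw [← hc]
      exact (cluster_congr fun u v hu => key u v (hc.subset hu)).symm
    · intro hc
      rw [← hc]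
      rw [← hc] at key
      exact (cluster_congr fun u v hu => (key u v hu).symm).symm
  · intro A _ C
    rw [pivotalEdges_sdiff]

/-- With `A₁` fixed, confinement forces every pivotal edge to be closed in `A₂`; the point is to
find the cluster without looking at these edges. -/
theorem bexp_cluster_pivotal_ge_le {q : ℝ} (hq0 : 0 ≤ q) (hq1 : q ≤ 1) {Λ : Finset V}
    (S : Set V) {A₁ : Finset (Sym2 V)} (hA₁ : A₁ ⊆ touching G Λ) (k : ℕ) :
    (bexp (touching G Λ) q fun A₂ =>
      ind (cluster (↑(A₁ ∪ A₂) : Set (Sym2 V)) S ⊆ Λ ∧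
        k ≤ (pivotalEdges G Λ (cluster (↑(A₁ ∪ A₂) : Set (Sym2 V)) S) A₁).card)) ≤
      (1 - q) ^ k := by
  -- A confined cluster lies in `K`, so it can be explored using only the edges `E` inside `K`. The
  -- pivotal edges lead from it out of `K`, hence belong to `D` and are independent of that
  -- exploration.
  let K : Set V := {v | cluster (A₁ : Set (Sym2 V)) {v} ⊆ Λ}
  let E : Finset (Sym2 V) := (touching G Λ).filter fun e => ∀ v ∈ e, v ∈ K
  let C : Finset (Sym2 V) → Set V := fun A₂ => cluster (↑((A₁ ∪ A₂) ∩ E) : Set (Sym2 V)) S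
  let D : Finset (Sym2 V) → Finset (Sym2 V) := fun A₂ =>
    (touching G Λ).filter fun e => ∃ u v, e = s(u, v) ∧ u ∈ C A₂ ∧ v ∉ K
  have hDE : ∀ A₂ ⊆ touching G Λ, D A₂ ⊆ touching G Λ \ E := by
    intro A₂ _ e he
    obtain ⟨heF, u, v, rfl, -, hv⟩ := Finset.mem_filter.1 he
    exact Finset.mem_sdiff.2 ⟨heF, fun h => hv ((Finset.mem_filter.1 h).2 v (by simp))⟩
  have hC : ∀ A₂ ⊆ touching G Λ, C (A₂ \ (touching G Λ \ E)) = C A₂ := by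
    intro A₂ _
    simp only [C]
    rw [Finset.union_inter_distrib_right, sdiff_inter_of_disjoint Finset.sdiff_disjoint,
      ← Finset.union_inter_distrib_right]
  have hD : ∀ A₂ ⊆ touching G Λ, D (A₂ \ (touching G Λ \ E)) = D A₂ := by
    intro A₂ h
    simp only [D, hC A₂ h]
  have e := bexp_mul_ind_disjoint (s := touching G Λ) Finset.sdiff_subset q
    (g := fun A₂ => ind (k ≤ (D A₂).card)) hDE hD fun A₂ h => by rw [hD A₂ h]
  have h1 : (bexp (touching G Λ) q fun A₂ =>
      ind (k ≤ (D A₂).card) * (1 - q) ^ (D A₂).card) ≤ (1 - q) ^ k := by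
    refine bexp_le hq0 hq1 fun A₂ _ => ?_
    by_cases hk : k ≤ (D A₂).card
    · rw [ind_true hk, one_mul]
      exact pow_le_pow_of_le_one (by linarith) (by linarith) hk
    · rw [ind_false hk, zero_mul]
      exact pow_nonneg (by linarith) _
  refine le_trans ?_ (e.trans_le h1)
  refine bexp_mono hq0 hq1 fun A₂ hA₂ => ?_
  rw [← ind_and]
  refine ind_mono ?_
  rintro ⟨hΛ, hk⟩
  have hcl := closed_cluster (↑(A₁ ∪ A₂) : Set (Sym2 V)) S
  have hsub : cluster (↑(A₁ ∪ A₂) : Set (Sym2 V)) S ⊆ K := fun u hu =>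
    (cluster_cluster_subset (by exact_mod_cast Finset.subset_union_left) hu).trans hΛ
  have hCC : cluster (↑(A₁ ∪ A₂) : Set (Sym2 V)) S = C A₂ := by
    refine cluster_congr fun u v hu => ?_
    rw [Finset.mem_coe, Finset.mem_coe, Finset.mem_inter]
    refine ⟨fun h => ⟨h, Finset.mem_filter.2 ⟨Finset.union_subset hA₁ hA₂ h, fun w hw => ?_⟩⟩,
      fun h => h.1⟩
    rcases Sym2.mem_iff.1 hw with rfl | rfl
    · exact hsub hu
    · exact hsub (hcl u w h hu)
  refine ⟨hk.trans (Finset.card_le_card ?_), ?_⟩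
  · intro e he
    obtain ⟨heF, u, v, rfl, hu, hv, hvΛ⟩ := Finset.mem_filter.1 he
    refine Finset.mem_filter.2 ⟨heF, u, v, rfl, hCC ▸ hu, fun hvK => hvΛ ?_⟩
    exact (cluster_mono (by exact_mod_cast Finset.sdiff_subset) subset_rfl).trans hvK
  · rw [Finset.disjoint_left]
    intro e he heD
    obtain ⟨-, u, v, rfl, hu, hv⟩ := Finset.mem_filter.1 heD
    rw [← hCC] at hu
    exact hv (hsub (hcl u v (Finset.mem_coe.2 (Finset.mem_union_right _ he)) hu))

theorem bexp_cluster_le {p q b : ℝ} (hp0 : 0 ≤ p) (hp1 : p < 1) (hq0 : 0 ≤ q) (hq1 : q ≤ 1)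
    (hb : 0 ≤ b) {Λ : Finset V} {n : ℕ}
    (h : ∀ C : Set V, (n : ℕ∞) ≤ cutsetSize G C → probInside G p C Λ ≤ b) (S : Set V) (k : ℕ) :
    (bexp (touching G Λ) (p + q - p * q) fun A =>
      ind (cluster (A : Set (Sym2 V)) S ⊆ Λ ∧
        (n : ℕ∞) ≤ cutsetSize G (cluster (A : Set (Sym2 V)) S))) ≤
      b / (1 - p) ^ k + (1 - q) ^ k := by
  rw [← bexp_bexp_union]
  have h1 := bexp_mono (s := touching G Λ) hp0 hp1.le fun A₁ _ =>
    bexp_mono (s := touching G Λ) hq0 hq1 fun A₂ _ => show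
      ind (cluster (↑(A₁ ∪ A₂) : Set (Sym2 V)) S ⊆ Λ ∧
        (n : ℕ∞) ≤ cutsetSize G (cluster (↑(A₁ ∪ A₂) : Set (Sym2 V)) S)) ≤
      ind ((cluster (↑(A₁ ∪ A₂) : Set (Sym2 V)) S ⊆ Λ ∧
        (n : ℕ∞) ≤ cutsetSize G (cluster (↑(A₁ ∪ A₂) : Set (Sym2 V)) S)) ∧
        (pivotalEdges G Λ (cluster (↑(A₁ ∪ A₂) : Set (Sym2 V)) S) A₁).card < k) +
      ind (cluster (↑(A₁ ∪ A₂) : Set (Sym2 V)) S ⊆ Λ ∧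
        k ≤ (pivotalEdges G Λ (cluster (↑(A₁ ∪ A₂) : Set (Sym2 V)) S) A₁).card) by
    generalize cluster (↑(A₁ ∪ A₂) : Set (Sym2 V)) S = C
    by_cases hC : C ⊆ Λ ∧ (n : ℕ∞) ≤ cutsetSize G C
    · rcases lt_or_ge (pivotalEdges G Λ C A₁).card k with hk | hk
      · rw [ind_true hC, ind_true ⟨hC, hk⟩]
        linarith [ind_nonneg (C ⊆ Λ ∧ k ≤ (pivotalEdges G Λ C A₁).card)]
      · rw [ind_true hC, ind_true (P := C ⊆ Λ ∧ k ≤ (pivotalEdges G Λ C A₁).card) ⟨hC.1, hk⟩]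
        linarith [ind_nonneg ((C ⊆ Λ ∧ (n : ℕ∞) ≤ cutsetSize G C) ∧
          (pivotalEdges G Λ C A₁).card < k)]
    · rw [ind_false hC]
      exact add_nonneg (ind_nonneg _) (ind_nonneg _)
  refine h1.trans ?_
  simp only [bexp_add]
  refine add_le_add ?_ ?_
  · rw [bexp_comm]
    exact bexp_le hq0 hq1 fun A₂ _ => bexp_cluster_pivotal_lt_le hp0 hp1 hb h S k
  · exact bexp_le hp0 hp1.le fun A₁ hA₁ => bexp_cluster_pivotal_ge_le hq0 hq1 S hA₁ k

/-- The finite volume version of the main theorem. -/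
theorem exists_bexp_cluster_le [Infinite V] (hc : G.Connected) (hG : IsTransitive G)
    {p₀ p θ : ℝ} (h0 : 0 ≤ p₀) (h01 : p₀ < p) (h1 : p ≤ 1) (hθ : 0 < θ) {o : V}
    (h : ∀ Λ, probInside G p₀ {o} Λ ≤ 1 - θ) :
    ∃ (ς : ℝ) (K : ℕ), 0 < ς ∧ ς < 1 ∧ 0 < K ∧ ∀ (S : Set V) (Λ : Finset V) (n : ℕ),
      (bexp (touching G Λ) p fun A => ind (cluster (A : Set (Sym2 V)) S ⊆ Λ ∧
        (n : ℕ∞) ≤ cutsetSize G (cluster (A : Set (Sym2 V)) S))) ≤ 2 * ς ^ (n / K) := by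
  obtain ⟨p₁, h2, h3⟩ := exists_between h01
  have h4 : p₁ < 1 := h3.trans_le h1
  have hp₁0 : 0 ≤ p₁ := h0.trans h2.le
  have hd : 0 < 1 - p₁ := by linarith
  obtain ⟨ρ, κ, hρ0, hρ1, hκ, hmain⟩ := exists_probInside_le_pow hc hG h0 h2 h4 hθ h
  set q := (p - p₁) / (1 - p₁) with hq
  have hq0 : 0 < q := div_pos (by linarith) hd
  have hq1 : q ≤ 1 := by rw [hq, div_le_one hd]; linarith
  have hpq : p = p₁ + q - p₁ * q := by rw [hq]; field_simp; ring
  -- Out of `(L + 1) * k` factors `ρ`, `L * k` pay for the denominator `(1 - p₁) ^ k` and `k`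
  -- remain.
  obtain ⟨L, hL⟩ := exists_pow_lt_of_lt_one hd hρ1
  refine ⟨max ρ (1 - q), κ * (L + 1), lt_max_of_lt_left hρ0, max_lt hρ1 (by linarith),
    Nat.mul_pos hκ (Nat.succ_pos L), fun S Λ n => ?_⟩
  set k := n / (κ * (L + 1)) with hk
  have hb := bexp_cluster_le (G := G) (Λ := Λ) (n := n) hp₁0 h4 hq0.le hq1
    (pow_nonneg hρ0.le (n / κ)) (fun C hC => hmain C Λ n hC) S k
  rw [← hpq] at hb
  refine hb.trans ?_
  have e1 : ρ ^ (n / κ) / (1 - p₁) ^ k ≤ ρ ^ k := by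
    rw [div_le_iff₀ (pow_pos hd k)]
    have : (L + 1) * k ≤ n / κ := by
      rw [Nat.le_div_iff_mul_le hκ]
      calc (L + 1) * k * κ = κ * (L + 1) * k := by ring
        _ ≤ n := Nat.mul_div_le n _
    calc ρ ^ (n / κ) ≤ ρ ^ ((L + 1) * k) := pow_le_pow_of_le_one hρ0.le hρ1.le this
      _ = ρ ^ k * (ρ ^ L) ^ k := by rw [pow_mul, pow_succ, mul_pow, mul_comm]
      _ ≤ ρ ^ k * (1 - p₁) ^ k := mul_le_mul_of_nonneg_left
        (pow_le_pow_left₀ (pow_nonneg hρ0.le L) hL.le k) (pow_nonneg hρ0.le k)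
  have e2 : ρ ^ k ≤ max ρ (1 - q) ^ k := pow_le_pow_left₀ hρ0.le (le_max_left _ _) k
  have e3 : (1 - q) ^ k ≤ max ρ (1 - q) ^ k :=
    pow_le_pow_left₀ (by linarith) (le_max_right _ _) k
  linarith

end FiniteVolume

/-! ### Finite marginals of the percolation measure. -/

section Measure

open Classical

variable {ι : Type*} [DecidableEq ι]

theorem measurableSet_inter_eq (F A : Finset ι) :
    MeasurableSet {ω : Set ι | ∀ i ∈ F, (i ∈ ω ↔ i ∈ A)} := by
  have : {ω : Set ι | ∀ i ∈ F, (i ∈ ω ↔ i ∈ A)} = ⋂ i ∈ F, {ω : Set ι | i ∈ ω ↔ i ∈ A} := by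
    ext ω; simp
  rw [this]
  refine Finset.measurableSet_biInter F fun i _ => ?_
  by_cases hi : i ∈ A
  · simpa [hi] using measurableSet_setOfPred.2 (measurable_set_mem i)
  · simp only [hi, iff_false]
    exact (measurableSet_setOfPred.2 (measurable_set_mem i)).compl

theorem setBernoulli_real_inter_eq {u : Set ι} {p : I} {F A : Finset ι} (hF : (F : Set ι) ⊆ u)
    (hA : A ⊆ F) : setBer(u, p).real {ω | ∀ i ∈ F, (i ∈ ω ↔ i ∈ A)} =
      (p : ℝ) ^ A.card * (1 - (p : ℝ)) ^ (F \ A).card := by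
  have hpre : (fun q : ι → Prop => {i | q i}) ⁻¹' {ω | ∀ i ∈ F, (i ∈ ω ↔ i ∈ A)} =
      Set.pi F (fun i => {i ∈ A}) := by
    ext q
    simp [Set.mem_pi]
  rw [measureReal_def, setBernoulli_apply', hpre, Measure.infinitePi_pi _ (fun _ _ => .of_discrete),
    ENNReal.toReal_prod, ← Finset.prod_sdiff hA, mul_comm]
  congr 1
  · rw [Finset.prod_eq_pow_card]
    intro i hi
    have hu : i ∈ u := hF (hA hi)
    simp [hi, hu]
  · rw [Finset.prod_eq_pow_card]
    intro i hi
    rw [Finset.mem_sdiff] at hi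
    have hu : i ∈ u := hF hi.1
    simp [hi.2, hu]

/-- The law of the restriction of a Bernoulli set to a finite set. -/
theorem setBernoulli_real_filter {u : Set ι} {p : I} {F : Finset ι} (hF : (F : Set ι) ⊆ u)
    (P : Finset ι → Prop) : MeasurableSet {ω : Set ι | P (F.filter (· ∈ ω))} ∧
      setBer(u, p).real {ω | P (F.filter (· ∈ ω))} = bexp F p fun A => ind (P A) := by
  have hset : {ω : Set ι | P (F.filter (· ∈ ω))} =
      ⋃ A ∈ F.powerset.filter P, {ω : Set ι | ∀ i ∈ F, (i ∈ ω ↔ i ∈ A)} := by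
    ext ω
    simp only [Set.mem_ofPred_eq, Set.mem_iUnion, Finset.mem_filter, Finset.mem_powerset,
      exists_prop]
    constructor
    · exact fun h => ⟨_, ⟨Finset.filter_subset _ _, h⟩, fun i hi => by simp [hi]⟩
    · rintro ⟨A, ⟨hA, hP⟩, h⟩
      have : F.filter (· ∈ ω) = A := by
        ext i
        rw [Finset.mem_filter]
        exact ⟨fun hi => (h i hi.1).1 hi.2, fun hi => ⟨hA hi, (h i (hA hi)).2 hi⟩⟩
      rwa [this]
  refine ⟨?_, ?_⟩
  · rw [hset]
    exact Finset.measurableSet_biUnion _ fun A _ => measurableSet_inter_eq F A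
  rw [hset, measureReal_biUnion_finset _ (fun A _ => measurableSet_inter_eq F A), Finset.sum_filter]
  · refine Finset.sum_congr rfl fun A hA => ?_
    change _ = (p : ℝ) ^ A.card * (1 - (p : ℝ)) ^ (F \ A).card * ind (P A)
    by_cases hP : P A
    · rw [if_pos hP, ind_true hP, mul_one, setBernoulli_real_inter_eq hF (Finset.mem_powerset.1 hA)]
    · rw [if_neg hP, ind_false hP, mul_zero]
  · intro A hA B hB hAB
    refine Set.disjoint_left.2 fun ω hωA hωB => hAB ?_
    have hA' := Finset.mem_powerset.1 (Finset.mem_filter.1 hA).1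
    have hB' := Finset.mem_powerset.1 (Finset.mem_filter.1 hB).1
    ext i
    exact ⟨fun hi => (hωB i (hA' hi)).1 ((hωA i (hA' hi)).2 hi),
      fun hi => (hωA i (hB' hi)).1 ((hωB i (hB' hi)).2 hi)⟩

theorem coe_filter_mem {ι : Type*} (F : Finset ι) (ω : Set ι) :
    ((F.filter (· ∈ ω) : Finset ι) : Set ι) = ω ∩ F := by
  ext i; simp [and_comm]

end Measure

instance {V : Type*} (G : SimpleGraph V) (p : I) :
    IsProbabilityMeasure (percolationMeasure G p) := by
  unfold percolationMeasure; infer_instance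

/-- At level `1` the cluster is all of `V`, so the set defining the critical point is nonempty and
has an element below `p`. -/
theorem exists_level_of_criticalPoint_lt {V : Type*} [Infinite V] [Countable V]
    {G : SimpleGraph V} (hc : G.Connected) {o : V}
    {p : I} (hp : criticalPoint G o < p) : ∃ p₀ : I, (p₀ : ℝ) < p ∧
      0 < (percolationMeasure G p₀).real {ω | ConnectedToInfinity ω {o}} := by
  have hne : {x : ℝ | ∃ p : I, (p : ℝ) = x ∧
      0 < percolationMeasure G p {ω | ConnectedToInfinity ω {o}}}.Nonempty := by
    refine ⟨1, 1, rfl, ?_⟩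
    rw [percolationMeasure, setBernoulli_one, Measure.dirac_apply_of_mem]
    · exact one_pos
    · have : cluster G.edgeSet {o} = Set.univ :=
        Set.eq_univ_of_forall fun v => ⟨o, rfl, by
          rw [SimpleGraph.fromEdgeSet_edgeSet]; exact hc.preconnected o v⟩
      rw [Set.mem_ofPred_eq, ConnectedToInfinity, this]
      exact Set.infinite_univ
  obtain ⟨_, ⟨p₀, rfl, h⟩, hlt⟩ := exists_lt_of_csInf_lt hne hp
  exact ⟨p₀, hlt, ENNReal.toReal_pos h.ne' (measure_ne_top _ _)⟩

/-! ### Passage to infinite volume. -/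

section InfiniteVolume

open Classical

variable {V : Type*} {G : SimpleGraph V} [G.LocallyFinite]

theorem countable_of_connected (hc : G.Connected) : Countable V := by
  obtain ⟨o⟩ := hc.nonempty
  have : (Set.univ : Set V) = ⋃ r, (ball G o r : Set V) := by
    ext v
    obtain ⟨r, hr⟩ := exists_mem_ball hc o v
    simpa using ⟨r, hr⟩
  rw [← Set.countable_univ_iff, this]
  exact Set.countable_iUnion fun r => (ball G o r).countable_toSet

theorem probInside_le_one_sub [Countable V] (p : I) (o : V) (Λ : Finset V) :
    probInside G p {o} Λ ≤
      1 - (percolationMeasure G p).real {ω | ConnectedToInfinity ω {o}} := by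
  obtain ⟨hm, he⟩ := setBernoulli_real_filter (p := p) (touching_subset_edgeSet (G := G) Λ)
    (fun A => cluster (A : Set (Sym2 V)) {o} ⊆ Λ)
  have hc := measureReal_compl (μ := percolationMeasure G p) hm
  rw [probReal_univ] at hc
  change _ = 1 - setBer(G.edgeSet, p).real _ at hc
  rw [he] at hc
  change _ = 1 - probInside G p {o} Λ at hc
  have hle : (percolationMeasure G p).real {ω | ConnectedToInfinity ω {o}} ≤
      (percolationMeasure G p).real
        {ω | cluster (↑((touching G Λ).filter (· ∈ ω)) : Set (Sym2 V)) {o} ⊆ Λ}ᶜ := by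
    refine ENNReal.toReal_mono (measure_ne_top _ _) (measure_mono_ae ?_)
    filter_upwards [(setBernoulli_ae_subset : ∀ᵐ s ∂setBer(G.edgeSet, p), s ⊆ G.edgeSet)] with ω hω
    intro hinf (h : cluster (↑((touching G Λ).filter (· ∈ ω)) : Set (Sym2 V)) {o} ⊆ Λ)
    rw [coe_filter_mem, cluster_inter_touching_subset_iff hω] at h
    exact hinf (Λ.finite_toSet.subset h)
  linarith

/-- A finite cluster lies in some ball around a fixed vertex, and the corresponding events increase
with the radius, so a bound uniform in `Λ` passes to the limit. -/
theorem measure_finite_cluster_le [Countable V] (hc : G.Connected) (p : I) (S : Set V)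
    (n : ℕ) {b : ℝ} (hb0 : 0 ≤ b)
    (hb : ∀ Λ : Finset V, (bexp (touching G Λ) p fun A =>
      ind (cluster (A : Set (Sym2 V)) S ⊆ Λ ∧
        (n : ℕ∞) ≤ cutsetSize G (cluster (A : Set (Sym2 V)) S))) ≤ b) :
    (percolationMeasure G p).real {ω | ¬ ConnectedToInfinity ω S ∧
      (n : ℕ∞) ≤ cutsetSize G (cluster ω S)} ≤ b := by
  obtain ⟨o⟩ := hc.nonempty
  let E : ℕ → Set (Set (Sym2 V)) := fun k =>
    {ω | ω ⊆ G.edgeSet ∧ cluster ω S ⊆ ball G o k ∧ (n : ℕ∞) ≤ cutsetSize G (cluster ω S)}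
  have hmono : Monotone E := fun k l hkl ω hω =>
    ⟨hω.1, hω.2.1.trans (by exact_mod_cast ball_mono o hkl), hω.2.2⟩
  have hE : ∀ k, percolationMeasure G p (E k) ≤ ENNReal.ofReal b := by
    intro k
    have hsub : E k ⊆ {ω | cluster (↑((touching G (ball G o k)).filter (· ∈ ω)) : Set (Sym2 V)) S ⊆
        ball G o k ∧ (n : ℕ∞) ≤ cutsetSize G
          (cluster (↑((touching G (ball G o k)).filter (· ∈ ω)) : Set (Sym2 V)) S)} := by
      rintro ω ⟨h1, h2, h3⟩
      rw [Set.mem_ofPred_eq, coe_filter_mem]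
      have h4 := (cluster_inter_touching_subset_iff h1).2 h2
      exact ⟨h4, by rwa [cluster_inter_touching h1 h4]⟩
    refine (measure_mono hsub).trans ?_
    rw [ENNReal.le_ofReal_iff_toReal_le (measure_ne_top _ _) hb0]
    exact (setBernoulli_real_filter (touching_subset_edgeSet (G := G) (ball G o k))
      (fun A => cluster (A : Set (Sym2 V)) S ⊆ ball G o k ∧
        (n : ℕ∞) ≤ cutsetSize G (cluster (A : Set (Sym2 V)) S))).2.trans_le (hb _)
  refine ENNReal.toReal_le_of_le_ofReal hb0 ?_
  calc percolationMeasure G p {ω | ¬ ConnectedToInfinity ω S ∧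
        (n : ℕ∞) ≤ cutsetSize G (cluster ω S)} ≤ percolationMeasure G p (⋃ k, E k) := by
        refine measure_mono_ae ?_
        filter_upwards [(setBernoulli_ae_subset : ∀ᵐ s ∂setBer(G.edgeSet, p), s ⊆ G.edgeSet)]
          with ω hω
        rintro ⟨h1, h2⟩
        obtain ⟨k, hk⟩ := exists_subset_ball hc o (Set.not_infinite.1 h1).toFinset
        refine Set.mem_iUnion.2 ⟨k, hω, fun v hv => hk ?_, h2⟩
        exact (Set.Finite.mem_toFinset _).2 hv
    _ = ⨆ k, percolationMeasure G p (E k) := hmono.measure_iUnion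
    _ ≤ ENNReal.ofReal b := iSup_le hE

end InfiniteVolume

/-- Combine an exponential bound with a multiplicative constant and a uniform bound into an
exponential bound without constant. -/
theorem exists_exp_bound {ς a : ℝ} (hs0 : 0 < ς) (hs1 : ς < 1) (ha : a < 1) {K : ℕ} (hK : 0 < K) :
    ∃ c : ℝ, 0 < c ∧ ∀ n : ℕ, 1 ≤ n → min (2 * ς ^ (n / K)) a ≤ Real.exp (-(c * n)) := by
  -- In `ς ^ i = t ^ i * t ^ i`, one factor absorbs the constant `2` once `t ^ i ≤ 1 / 2`.
  set t := Real.sqrt ς with ht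
  have ht0 : 0 < t := Real.sqrt_pos.2 hs0
  have htt : t * t = ς := Real.mul_self_sqrt hs0.le
  have ht1 : t < 1 := by rw [ht, Real.sqrt_lt' one_pos]; linarith
  obtain ⟨k, hk⟩ := exists_pow_lt_of_lt_one (by norm_num : (0 : ℝ) < 1 / 2) ht1
  -- The maximum keeps the logarithm meaningful, since `a` need not be positive.
  set b := max a (1 / 2) with hb
  have hb0 : 0 < b := lt_max_of_lt_right (by norm_num)
  have hb1 : b < 1 := max_lt ha (by norm_num)
  have hlt : 0 < -Real.log t := neg_pos.2 (Real.log_neg ht0 ht1)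
  have hlb : 0 < -Real.log b := neg_pos.2 (Real.log_neg hb0 hb1)
  have hK' : (0 : ℝ) < K := Nat.cast_pos.2 hK
  have hN : (0 : ℝ) < K * (k + 1) := by positivity
  refine ⟨min (-Real.log t / (2 * K)) (-Real.log b / (K * (k + 1))),
    lt_min (by positivity) (by positivity), fun n hn => ?_⟩
  have hn0 : (0 : ℝ) ≤ n := Nat.cast_nonneg n
  by_cases hnk : n < K * (k + 1)
  · refine (min_le_right _ _).trans ((le_max_left a (1 / 2)).trans ?_)
    rw [← hb, ← Real.exp_log hb0, Real.exp_le_exp, le_neg, Real.log_exp]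
    have h1 : (n : ℝ) ≤ K * (k + 1) := by exact_mod_cast hnk.le
    calc _ ≤ -Real.log b / (K * (k + 1)) * n :=
          mul_le_mul_of_nonneg_right (min_le_right _ _) hn0
      _ ≤ -Real.log b / (K * (k + 1)) * (K * (k + 1)) :=
          mul_le_mul_of_nonneg_left h1 (by positivity)
      _ = -Real.log b := div_mul_cancel₀ _ hN.ne'
  · push Not at hnk
    -- The extra `1` guarantees `1 ≤ n / K`, which gives `n ≤ 2 * K * (n / K)` despite the rounding.
    have hq : k + 1 ≤ n / K := (Nat.le_div_iff_mul_le hK).2 (by rwa [mul_comm])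
    refine (min_le_left _ _).trans ?_
    have h1 : 2 * ς ^ (n / K) ≤ t ^ (n / K) := by
      have : t ^ (n / K) ≤ 1 / 2 :=
        (pow_le_pow_of_le_one ht0.le ht1.le (by omega : k ≤ n / K)).trans hk.le
      rw [← htt, mul_pow]
      nlinarith [pow_pos ht0 (n / K)]
    refine h1.trans ?_
    rw [← Real.exp_log (pow_pos ht0 _), Real.exp_le_exp, Real.log_pow]
    have h2 : n ≤ 2 * K * (n / K) := by
      have h3 := Nat.lt_mul_div_succ n hK
      nlinarith
    have h2' : (n : ℝ) ≤ 2 * K * (n / K : ℕ) := by exact_mod_cast h2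
    have h4 : min (-Real.log t / (2 * K)) (-Real.log b / (K * (k + 1))) * n ≤
        -Real.log t * (n / K : ℕ) :=
      calc _ ≤ -Real.log t / (2 * K) * n := mul_le_mul_of_nonneg_right (min_le_left _ _) hn0
        _ ≤ -Real.log t / (2 * K) * (2 * K * (n / K : ℕ)) :=
            mul_le_mul_of_nonneg_left h2' (by positivity)
        _ = -Real.log t * (n / K : ℕ) := by field_simp
    linarith

end Percolation

theorem theorem1p2 {V : Type*} [Infinite V] (G : SimpleGraph V) [G.LocallyFinite]
    (hconn : G.Connected) (htrans : Percolation.IsTransitive G) (o : V) (p : I)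
    (hp : Percolation.criticalPoint G o < (p : ℝ)) :
    ∃ c : ℝ, 0 < c ∧ ∀ (S : Finset V) (n : ℕ), 1 ≤ n →
      (Percolation.percolationMeasure G p).real
          {ω | ¬ Percolation.ConnectedToInfinity ω (S : Set V) ∧
            (n : ℕ∞) ≤ Percolation.cutsetSize G (Percolation.cluster ω (S : Set V))}
        ≤ Real.exp (-(c * (n : ℝ))) := by
  open Percolation in
  classical
  have := countable_of_connected hconn
  obtain ⟨p₀, hlt, hθ⟩ := exists_level_of_criticalPoint_lt hconn hp
  set θ := (percolationMeasure G p₀).real {ω | ConnectedToInfinity ω {o}} with hθdef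
  have hθ1 : θ ≤ 1 := measureReal_le_one
  have h1 : ∀ Λ, probInside G p₀ {o} Λ ≤ 1 - θ := probInside_le_one_sub p₀ o
  obtain ⟨ς, K, hs0, hs1, hK, hmain⟩ :=
    exists_bexp_cluster_le hconn htrans p₀.2.1 hlt p.2.2 hθ h1
  obtain ⟨c, hc, hexp⟩ := exists_exp_bound hs0 hs1 (by linarith : 1 - θ < 1) hK
  refine ⟨c, hc, fun S n hn => ?_⟩
  refine measure_finite_cluster_le hconn p S n (Real.exp_pos _).le fun Λ =>
    (le_min (hmain S Λ n) ?_).trans (hexp n hn)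
  -- For empty `S` the cutset size is `0 < n` and the event is impossible; otherwise a single vertex
  -- of `S` already gives the bound `1 - θ`.
  rcases S.eq_empty_or_nonempty with rfl | ⟨s, hs⟩
  · refine (bexp_le p.2.1 p.2.2 fun A _ => (ind_false ?_).le).trans (by linarith)
    rintro ⟨-, h⟩
    rw [Finset.coe_empty, cluster_empty] at h
    have h0 : cutsetSize G (∅ : Set V) ≤ (edgeBoundary G (∅ : Set V)).encard :=
      iInf₂_le_of_le ∅ subset_rfl (iInf_le _ Set.finite_empty)
    have h2 : edgeBoundary G (∅ : Set V) = ∅ := by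
      ext e; simp [edgeBoundary]
    rw [h2, Set.encard_empty] at h0
    have h3 : (n : ℕ∞) ≤ 0 := h.trans h0
    have h4 : n ≤ 0 := by exact_mod_cast h3
    omega
  · calc _ ≤ probInside G p S Λ := bexp_ind_mono p.2.1 p.2.2 fun A _ h => h.1
      _ ≤ probInside G p {s} Λ := probInside_anti p.2.1 p.2.2 (by simpa using hs) Λ
      _ ≤ probInside G p₀ {s} Λ := probInside_level p₀.2.1 p₀.2.2 hlt.le p.2.2 _ Λ
      _ ≤ 1 - θ := probInside_le_of_transitive htrans h1 s Λ
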